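/- A Bayesian contextual bandit problem $\Phi$ consists of a prior law $\mathbb{P}_\Theta$ of a parameter $\Theta\in\mathcal{O}$ ($\mathcal O$ a standard Borel space), a law $\mathbb{P}_X$ on a measurable space $\mathcal X$ of contexts, a finite set $\mathcal{A}$ of actions, and a reward kernel giving the law of the real random reward $R(x,a,\theta)$ for $x\in\mathcal X$, $a\in\mathcal A$, $\theta\in\mathcal O$. The contexts $X_1,X_2,\dots$ are independent with law $\mathbb{P}_X$ and independent of $\Theta$. Fix $T\in\mathbb{N}$. Let $R^\star_\Phi=\sup_\psi \mathbb{E}\big[\sum_{t=1}^T R(X_t,\psi(X_t,\Theta),\Theta)\big]$, the supremum being over the measurable $\psi:\mathcal X\times\mathcal O\to\mathcal A$ for which the expectation is defined, and let $\psi^\star$ attain it. Thompson Sampling, in round $t$, observes $X_t$, samples $\hat\Theta_t$ from the posterior $\mathbb{P}_{\Theta\mid \hat H^t}$ of $\Theta$ given the history $\hat H^t=(\hat A_s,X_s,R_s)_{s<t}$ (independently of $X_t$ and $\Theta$ given $\hat H^t$), plays $\hat A_t=\psi^\star(X_t,\hat\Theta_t)$ and collects $R_t=R(X_t,\hat A_t,\Theta)$.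 Its regret is $\mathrm{REG}^{\mathrm{TS}}_\Phi=R^\star_\Phi-\mathbb{E}\big[\sum_{t=1}^T R_t\big]$. Let $\mathrm{H}(\Theta)\in[0,\infty]$ be the Shannon entropy of $\Theta$ in nats, $\mathrm{H}(\Theta)=-\sum_\theta \mathbb{P}_\Theta(\{\theta\})\log\mathbb{P}_\Theta(\{\theta\})$ if $\mathbb{P}_\Theta$ is carried by a countable set, and $\mathrm{H}(\Theta)=\infty$ otherwise (with $0\cdot\infty=0$). (i) If the rewards are bounded in $[0,L]$, that is, for all $x,a,\theta$ one has $R(x,a,\theta)\in[0,L]$ almost surely, then $$\mathrm{REG}^{\mathrm{TS}}_\Phi\le\sqrt{\frac{L^2\,|\mathcal A|\,T\,\mathrm{H}(\Theta)}{2}} .$$ (ii) If the rewards are $\sigma^2$-sub-Gaussian, that is, for every $t\in\{1,\dots,T\}$, for almost every history $h$ and context $x$, and every action $a$ with $\mathbb{P}[\hat A_t=a\mid \hat H^t=h,X_t=x]>0$, the law $\nu$ of $R(x,a,\Theta)$ given $\hat H^t=h$ (equivalently, the law of $R_t$ given $\hat H^t=h$, $X_t=x$, $\hat A_t=a$) satisfies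 $\int e^{s(r-m)}\,\nu(dr)\le e^{\sigma^2s^2/2}$ for all $s\in\mathbb R$, where $m=\int r\,\nu(dr)$, then $$\mathrm{REG}^{\mathrm{TS}}_\Phi\le\sqrt{2\sigma^2\,|\mathcal A|\,T\,\mathrm{H}(\Theta)} .$$ -/

import Mathlib

open MeasureTheory ProbabilityTheory
open scoped ENNReal NNReal

noncomputable section

/-- A Bayesian contextual bandit problem: a prior for the environment parameter, a distribution of
the contexts (drawn afresh and independently in each round), and a reward kernel, which gives the
law of the reward `R(x, a, θ)` for a context `x`, an action `a` and a parameter `θ`. -/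
structure ContextualBandit (𝒳 𝒜 𝒪 : Type*) [MeasurableSpace 𝒳] [MeasurableSpace 𝒜]
    [MeasurableSpace 𝒪] where
  prior : Measure 𝒪
  context : Measure 𝒳
  reward : Kernel (𝒳 × 𝒜 × 𝒪) ℝ
  isProb_prior : IsProbabilityMeasure prior
  isProb_context : IsProbabilityMeasure context
  isMarkov_reward : IsMarkovKernel reward

/-- A decision rule `ψ : 𝒳 × 𝒪 → 𝒜`. -/
abbrev DecisionRule (𝒳 𝒜 𝒪 : Type*) [MeasurableSpace 𝒳] [MeasurableSpace 𝒜]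
    [MeasurableSpace 𝒪] : Type _ :=
  {ψ : 𝒳 × 𝒪 → 𝒜 // Measurable ψ}

/-- A history of `t` rounds: the action, the context and the reward of each round. -/
abbrev BanditHistory (𝒳 𝒜 : Type*) (t : ℕ) : Type _ := Fin t → 𝒜 × 𝒳 × ℝ

open Classical in
/-- The Shannon entropy (in nats) of a random variable with law `μ`, with value `∞` if the law is
not carried by a countable set. -/
def shannonEntropy {S : Type*} [MeasurableSpace S] (μ : Measure S) : ℝ≥0∞ :=
  if ∃ C : Set S, C.Countable ∧ μ Cᶜ = 0 then
    ∑' s : S, ENNReal.ofReal (Real.negMulLog (μ.real {s}))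
  else ∞

/-- A probability measure on the real line is `v`-sub-Gaussian (with variance proxy `v`) if its
centred moment generating function is at most `exp (v * s ^ 2 / 2)` at every real `s`. -/
def IsSubGaussianLaw (v : ℝ≥0) (ν : Measure ℝ) : Prop :=
  HasSubgaussianMGF (fun r : ℝ => r - ∫ u, u ∂ν) v ν

theorem measurable_history_snoc {𝒳 𝒜 : Type*} [MeasurableSpace 𝒳] [MeasurableSpace 𝒜] (t : ℕ) :
    Measurable (fun p : BanditHistory 𝒳 𝒜 t × (𝒜 × 𝒳 × ℝ) =>
      (Fin.snoc p.1 p.2 : BanditHistory 𝒳 𝒜 (t + 1))) := by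
  refine measurable_pi_lambda _ fun i => ?_
  induction i using Fin.lastCases with
  | last => simpa using measurable_snd
  | cast j =>
    simp only [Fin.snoc_castSucc]
    exact (measurable_pi_apply j).comp measurable_fst

namespace ContextualBandit

variable {𝒳 𝒜 𝒪 : Type*} [MeasurableSpace 𝒳] [MeasurableSpace 𝒜] [MeasurableSpace 𝒪]

instance (Φ : ContextualBandit 𝒳 𝒜 𝒪) : IsProbabilityMeasure Φ.prior := Φ.isProb_prior
instance (Φ : ContextualBandit 𝒳 𝒜 𝒪) : IsProbabilityMeasure Φ.context := Φ.isProb_context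
instance (Φ : ContextualBandit 𝒳 𝒜 𝒪) : IsMarkovKernel Φ.reward := Φ.isMarkov_reward

/-- The rewards are bounded in `[0, L]`. -/
def RewardsIn (Φ : ContextualBandit 𝒳 𝒜 𝒪) (L : ℝ) : Prop :=
  ∀ x a θ, ∀ᵐ r ∂(Φ.reward (x, a, θ)), r ∈ Set.Icc 0 L

section Oracle

/-- The law of `R(X, ψ(X, Θ), Θ)`, the reward in one round of a player who knows `Θ` and follows
the decision rule `ψ`, where the context `X` is independent of `Θ`. -/
def ruleRewardLaw (Φ : ContextualBandit 𝒳 𝒜 𝒪) (ψ : DecisionRule 𝒳 𝒜 𝒪) : Measure ℝ :=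
  (Φ.reward.comap (fun p : 𝒳 × 𝒪 => (p.1, ψ.1 p, p.2))
    (measurable_fst.prodMk (ψ.2.prodMk measurable_snd))) ∘ₘ (Φ.context.prod Φ.prior)

/-- The decision rules whose expected reward is defined. -/
def IsAdmissibleRule (Φ : ContextualBandit 𝒳 𝒜 𝒪) (ψ : DecisionRule 𝒳 𝒜 𝒪) : Prop :=
  Integrable (fun r : ℝ => r) (Φ.ruleRewardLaw ψ)

/-- The expected cumulative reward `E[∑ t, R(X_t, ψ(X_t, Θ), Θ)]` of a decision rule in `T`
rounds; the contexts are identically distributed, and so are the summands. -/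
def ruleReward (Φ : ContextualBandit 𝒳 𝒜 𝒪) (T : ℕ) (ψ : DecisionRule 𝒳 𝒜 𝒪) : ℝ :=
  ∑ _t ∈ Finset.range T, ∫ r, r ∂(Φ.ruleRewardLaw ψ)

/-- The optimal cumulative reward: the supremum over the admissible decision rules. -/
def optimalReward (Φ : ContextualBandit 𝒳 𝒜 𝒪) (T : ℕ) : ℝ :=
  sSup (Φ.ruleReward T '' {ψ | Φ.IsAdmissibleRule ψ})

/-- An optimal decision rule `ψ⋆`: it is admissible and attains the supremum. -/
def IsOptimalRule (Φ : ContextualBandit 𝒳 𝒜 𝒪) (T : ℕ) (ψ : DecisionRule 𝒳 𝒜 𝒪) : Prop :=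
  Φ.IsAdmissibleRule ψ ∧ ∀ ψ', Φ.IsAdmissibleRule ψ' → Φ.ruleReward T ψ' ≤ Φ.ruleReward T ψ

end Oracle

section ThompsonSampling

/-- One round of Thompson Sampling, given the parameter `θ` and the history `h`. The context `x` is
drawn from the context distribution and, independently, the estimate `θ'` from the posterior
`post h`; the action is `ψ (x, θ')` and the reward is drawn from `reward (x, ψ (x, θ'), θ)`. The
outcome is the triple of the action, the context and the reward. -/
def tsRound (Φ : ContextualBandit 𝒳 𝒜 𝒪) (ψ : DecisionRule 𝒳 𝒜 𝒪) {t : ℕ}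
    (post : Kernel (BanditHistory 𝒳 𝒜 t) 𝒪) :
    Kernel (𝒪 × BanditHistory 𝒳 𝒜 t) (𝒜 × 𝒳 × ℝ) :=
  (((Kernel.const _ Φ.context) ×ₖ (post.comap Prod.snd measurable_snd)) ⊗ₖ
    (Φ.reward.comap
      (fun z : (𝒪 × BanditHistory 𝒳 𝒜 t) × (𝒳 × 𝒪) => (z.2.1, ψ.1 z.2, z.1.1))
      ((measurable_fst.comp measurable_snd).prodMk
        ((ψ.2.comp measurable_snd).prodMk (measurable_fst.comp measurable_fst))))).map
    (fun w : (𝒳 × 𝒪) × ℝ => (ψ.1 w.1, w.1.1, w.2))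

instance (Φ : ContextualBandit 𝒳 𝒜 𝒪) (ψ : DecisionRule 𝒳 𝒜 𝒪) {t : ℕ}
    (post : Kernel (BanditHistory 𝒳 𝒜 t) 𝒪) [IsMarkovKernel post] :
    IsMarkovKernel (Φ.tsRound ψ post) :=
  Kernel.IsMarkovKernel.map _
    ((ψ.2.comp measurable_fst).prodMk ((measurable_fst.comp measurable_fst).prodMk measurable_snd))

variable [StandardBorelSpace 𝒪] [Nonempty 𝒪]

/-- The conditional law, given the parameter, of the history that Thompson Sampling collects in the
first `t` rounds, as a Markov kernel. In each round the estimate is sampled from the posterior of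
the parameter given the history so far. -/
def tsHistoryAux (Φ : ContextualBandit 𝒳 𝒜 𝒪) (ψ : DecisionRule 𝒳 𝒜 𝒪) :
    (t : ℕ) → {κ : Kernel 𝒪 (BanditHistory 𝒳 𝒜 t) // IsMarkovKernel κ}
  | 0 => ⟨Kernel.const 𝒪 (Measure.dirac Fin.elim0), inferInstance⟩
  | t + 1 =>
    haveI := (tsHistoryAux Φ ψ t).2
    ⟨((tsHistoryAux Φ ψ t).1 ⊗ₖ
        Φ.tsRound ψ (posterior (tsHistoryAux Φ ψ t).1 Φ.prior)).map
        (fun p : BanditHistory 𝒳 𝒜 t × (𝒜 × 𝒳 × ℝ) =>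
          (Fin.snoc p.1 p.2 : BanditHistory 𝒳 𝒜 (t + 1))),
      Kernel.IsMarkovKernel.map _ (measurable_history_snoc t)⟩

/-- The conditional law, given the parameter, of the history that Thompson Sampling collects in the
first `t` rounds. -/
def tsHistory (Φ : ContextualBandit 𝒳 𝒜 𝒪) (ψ : DecisionRule 𝒳 𝒜 𝒪) (t : ℕ) :
    Kernel 𝒪 (BanditHistory 𝒳 𝒜 t) :=
  (Φ.tsHistoryAux ψ t).1

instance (Φ : ContextualBandit 𝒳 𝒜 𝒪) (ψ : DecisionRule 𝒳 𝒜 𝒪) (t : ℕ) :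
    IsMarkovKernel (Φ.tsHistory ψ t) :=
  (Φ.tsHistoryAux ψ t).2

/-- The posterior law of the parameter given the Thompson Sampling history of `t` rounds. -/
def tsPosterior (Φ : ContextualBandit 𝒳 𝒜 𝒪) (ψ : DecisionRule 𝒳 𝒜 𝒪) (t : ℕ) :
    Kernel (BanditHistory 𝒳 𝒜 t) 𝒪 :=
  posterior (Φ.tsHistory ψ t) Φ.prior

instance (Φ : ContextualBandit 𝒳 𝒜 𝒪) (ψ : DecisionRule 𝒳 𝒜 𝒪) (t : ℕ) :
    IsMarkovKernel (Φ.tsPosterior ψ t) := by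
  unfold tsPosterior; infer_instance

theorem tsHistory_succ (Φ : ContextualBandit 𝒳 𝒜 𝒪) (ψ : DecisionRule 𝒳 𝒜 𝒪) (t : ℕ) :
    Φ.tsHistory ψ (t + 1) =
      (Φ.tsHistory ψ t ⊗ₖ Φ.tsRound ψ (Φ.tsPosterior ψ t)).map
        (fun p : BanditHistory 𝒳 𝒜 t × (𝒜 × 𝒳 × ℝ) =>
          (Fin.snoc p.1 p.2 : BanditHistory 𝒳 𝒜 (t + 1))) :=
  rfl

/-- The expected cumulative reward of Thompson Sampling in `T` rounds. -/
def tsReward (Φ : ContextualBandit 𝒳 𝒜 𝒪) (T : ℕ) (ψ : DecisionRule 𝒳 𝒜 𝒪) : ℝ :=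
  ∫ h, ∑ i : Fin T, (h i).2.2 ∂(Φ.tsHistory ψ T ∘ₘ Φ.prior)

/-- The Thompson Sampling cumulative regret (its Bayesian expected regret) after `T` rounds. -/
def tsRegret (Φ : ContextualBandit 𝒳 𝒜 𝒪) (T : ℕ) (ψ : DecisionRule 𝒳 𝒜 𝒪) : ℝ :=
  Φ.optimalReward T - Φ.tsReward T ψ

/-- The law of the reward in round `t + 1`, given that the history is `h`, the context is `x` and
the action is `a`: the law of `R(x, a, Θ)` for `Θ` drawn from the posterior given `h`. -/
def tsPredictive (Φ : ContextualBandit 𝒳 𝒜 𝒪) (ψ : DecisionRule 𝒳 𝒜 𝒪) (t : ℕ)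
    (h : BanditHistory 𝒳 𝒜 t) (x : 𝒳) (a : 𝒜) : Measure ℝ :=
  (Φ.reward.comap (fun θ : 𝒪 => (x, a, θ))
    (measurable_const.prodMk (measurable_const.prodMk measurable_id))) ∘ₘ (Φ.tsPosterior ψ t h)

/-- The rewards are `v`-sub-Gaussian in the first `T` rounds: given almost every history and
context, and given any action that Thompson Sampling then takes with positive probability, the
conditional law of the reward is `v`-sub-Gaussian. -/
def SubGaussianRewards (Φ : ContextualBandit 𝒳 𝒜 𝒪) (T : ℕ) (ψ : DecisionRule 𝒳 𝒜 𝒪)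
    (v : ℝ≥0) : Prop :=
  ∀ t < T, ∀ᵐ h ∂(Φ.tsHistory ψ t ∘ₘ Φ.prior), ∀ᵐ x ∂Φ.context, ∀ a : 𝒜,
    Φ.tsPosterior ψ t h {θ | ψ.1 (x, θ) = a} ≠ 0 →
      IsSubGaussianLaw v (Φ.tsPredictive ψ t h x a)

end ThompsonSampling

end ContextualBandit

end

/-! The proof compares the joint law of parameter and history with the product of their marginals,
through one test function. Fix `lam`. In a round with posterior `π`, let `p a` be the posterior
probability that `a` is optimal and `m a` the predictive mean of its reward. The score of a triple
of parameter `θ`, played action `a` and reward `r` is `lam / p a * (r - m a) - v * (lam / p a) ^ 2 /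
2` if `a` is optimal for `θ`, and `0` otherwise.

Two facts about the score carry everything. If `θ` is frozen and the action and reward follow their
law given history and context alone, then `r` has the predictive law of `a`, and sub-Gaussianity
makes the exponential of the score integrate to at most one (`lintegral_exp_roundScore_le`). Under
the true law, Thompson Sampling plays `a` with probability `p a` independently of `θ`; this cancels
the weight `1 / p a`, and the expected score is at least `lam` times the conditional regret minus
`card 𝒜 * v * lam ^ 2 / 2` (`le_integral_roundScore`).

The scores add up over the rounds to a potential `W` (`exists_potential`). For each fixed `θ` the
exponential of `W` has mean at most one under the marginal law of the history, so the mean of `W`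
under the joint law is at most the entropy of the prior (`integral_compProd_le_shannonEntropy`).
Hence `lam * R ≤ H + T * card 𝒜 * v * lam ^ 2 / 2` for the regret `R` and the entropy `H`, and a
discriminant argument gives `R ≤ √(2 * v * card 𝒜 * T * H)`. The bounded case is the case `v = (L /
2) ^ 2`, by Hoeffding's lemma. -/

/-! ### Sub-Gaussian laws on the line. -/

theorem IsSubGaussianLaw.integrable {v : ℝ≥0} {ν : Measure ℝ} [IsProbabilityMeasure ν]
    (h : IsSubGaussianLaw v ν) : Integrable (fun r : ℝ => r) ν := by
  have h1 : Integrable (fun r : ℝ => r - ∫ u, u ∂ν) ν := HasSubgaussianMGF.integrable h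
  exact (h1.add (integrable_const (∫ u, u ∂ν))).congr (ae_of_all _ fun r => sub_add_cancel r _)

/-- The mean absolute deviation of a sub-Gaussian law is bounded in terms of the variance proxy. -/
theorem IsSubGaussianLaw.integral_abs_sub_le {v : ℝ≥0} {ν : Measure ℝ} [IsProbabilityMeasure ν]
    (h : IsSubGaussianLaw v ν) {s : ℝ} (hs : 0 < s) :
    ∫ r, |r - ∫ u, u ∂ν| ∂ν ≤ 2 * Real.exp (v * s ^ 2 / 2) / s := by
  set m := ∫ u, u ∂ν
  have h1 := HasSubgaussianMGF.integrable_exp_mul h s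
  have h2 := HasSubgaussianMGF.integrable_exp_mul h (-s)
  have b1 := HasSubgaussianMGF.mgf_le h s
  have b2 := HasSubgaussianMGF.mgf_le h (-s)
  rw [mgf] at b1 b2
  -- From `1 + x ≤ exp x`, applied at `x = s * (r - m)` and at its negative.
  have key : ∀ r : ℝ, |r - m| ≤ (Real.exp (s * (r - m)) + Real.exp (-s * (r - m))) / s := by
    intro r
    rw [le_div_iff₀ hs]
    have e1 := Real.add_one_le_exp (s * (r - m))
    have e2 := Real.add_one_le_exp (-s * (r - m))
    have e3 := Real.exp_pos (s * (r - m))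
    have e4 := Real.exp_pos (-s * (r - m))
    rcases abs_cases (r - m) with ⟨h, _⟩ | ⟨h, _⟩ <;> rw [h] <;> nlinarith
  calc ∫ r, |r - m| ∂ν ≤ ∫ r, (Real.exp (s * (r - m)) + Real.exp (-s * (r - m))) / s ∂ν :=
        integral_mono ((h.integrable.sub (integrable_const _)).abs) ((h1.add h2).div_const s) key
    _ = (∫ r, Real.exp (s * (r - m)) ∂ν + ∫ r, Real.exp (-s * (r - m)) ∂ν) / s := by
        rw [integral_div, integral_add h1 h2]
    _ ≤ _ := by
        gcongr
        have : ((-s) ^ 2) = s ^ 2 := by ring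
        rw [this] at b2
        linarith

theorem IsSubGaussianLaw.lintegral_exp_le {v : ℝ≥0} {ν : Measure ℝ} [IsProbabilityMeasure ν]
    (h : IsSubGaussianLaw v ν) (c : ℝ) :
    ∫⁻ r, ENNReal.ofReal (Real.exp (c * (r - ∫ u, u ∂ν) - v * c ^ 2 / 2)) ∂ν ≤ 1 := by
  have h1 := HasSubgaussianMGF.integrable_exp_mul h c
  have b1 := HasSubgaussianMGF.mgf_le h c
  rw [mgf] at b1
  simp_rw [Real.exp_sub]
  rw [← ofReal_integral_eq_lintegral_ofReal (h1.div_const _)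
    (ae_of_all _ fun r => by positivity), integral_div]
  rw [← ENNReal.ofReal_one]
  exact ENNReal.ofReal_le_ofReal ((div_le_one (Real.exp_pos _)).2 b1)

/-- Hoeffding's lemma: the variance proxy is the square of half the length of the interval. -/
theorem isSubGaussianLaw_of_mem_Icc {ν : Measure ℝ} [IsProbabilityMeasure ν] {L : ℝ≥0}
    (h : ∀ᵐ r ∂ν, r ∈ Set.Icc 0 (L : ℝ)) : IsSubGaussianLaw ((L / 2) ^ 2) ν := by
  have := hasSubgaussianMGF_of_mem_Icc (X := fun r : ℝ => r) (μ := ν) aemeasurable_id h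
  unfold IsSubGaussianLaw
  convert this using 3
  ext; simp

/-! ### The laws of one round, decomposed by action. -/

section OneRound

variable {𝒜 𝒪 : Type*} [MeasurableSpace 𝒜] [MeasurableSpace 𝒪]

/-- The law of an action, a parameter and a reward when the parameter `θ` has law `π`, the action is
`f θ'` for an independent copy `θ'` of `θ`, and the reward is drawn from `ρ (θ, f θ')`. -/
noncomputable def sampledLaw (π : Measure 𝒪) (f : 𝒪 → 𝒜) (ρ : Kernel (𝒪 × 𝒜) ℝ) :
    Measure ((𝒪 × 𝒜) × ℝ) :=
  (π.prod (π.map f)) ⊗ₘ ρ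

/-- The law of the parameter and of the reward of the action `a`. -/
noncomputable def actionLaw (π : Measure 𝒪) (ρ : Kernel (𝒪 × 𝒜) ℝ) (a : 𝒜) : Measure (𝒪 × ℝ) :=
  π ⊗ₘ (ρ.comap (fun θ => (θ, a)) (by fun_prop))

/-- The law of the reward when the action is `f θ`. -/
noncomputable def informedLaw (π : Measure 𝒪) {f : 𝒪 → 𝒜} (hf : Measurable f)
    (ρ : Kernel (𝒪 × 𝒜) ℝ) : Measure ℝ :=
  (ρ.comap (fun θ => (θ, f θ)) (by fun_prop)) ∘ₘ π

variable (π : Measure 𝒪) [IsProbabilityMeasure π] {f : 𝒪 → 𝒜} (hf : Measurable f)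
  (ρ : Kernel (𝒪 × 𝒜) ℝ) [IsMarkovKernel ρ]

instance (a : 𝒜) : IsProbabilityMeasure (actionLaw π ρ a) := by
  unfold actionLaw; infer_instance

theorem map_snd_actionLaw (a : 𝒜) :
    (actionLaw π ρ a).map Prod.snd = (ρ.comap (fun θ => (θ, a)) (by fun_prop)) ∘ₘ π :=
  Measure.snd_compProd _ _

theorem map_fst_actionLaw (a : 𝒜) : (actionLaw π ρ a).map Prod.fst = π :=
  Measure.fst_compProd _ _

theorem actionLaw_preimage (a : 𝒜) {s : Set 𝒪} (hs : MeasurableSet s) :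
    actionLaw π ρ a (Prod.fst ⁻¹' s) = π s := by
  rw [← Measure.map_apply measurable_fst hs, map_fst_actionLaw]

theorem actionLaw_real_preimage (a : 𝒜) {s : Set 𝒪} (hs : MeasurableSet s) :
    (actionLaw π ρ a).real (Prod.fst ⁻¹' s) = π.real s := by
  rw [Measure.real, actionLaw_preimage _ _ _ hs]; rfl

theorem integral_snd_actionLaw (a : 𝒜) {F : ℝ → ℝ} (hF : Measurable F) :
    ∫ q, F q.2 ∂(actionLaw π ρ a) = ∫ r, F r ∂((ρ.comap (fun θ => (θ, a)) (by fun_prop)) ∘ₘ π) := by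
  rw [← map_snd_actionLaw, integral_map (by fun_prop) hF.aestronglyMeasurable]

variable [Fintype 𝒜] [MeasurableSingletonClass 𝒜]

include hf in
theorem sampledLaw_eq_sum : sampledLaw π f ρ =
    ∑ a, π (f ⁻¹' {a}) • (actionLaw π ρ a).map (fun q => ((q.1, a), q.2)) := by
  have := Measure.isProbabilityMeasure_map (μ := π) hf.aemeasurable
  refine Measure.ext_of_lintegral _ fun F hF => ?_
  rw [lintegral_finsetSum_measure, sampledLaw, Measure.lintegral_compProd hF, lintegral_prod_symm _
    (Measurable.aemeasurable (by fun_prop)), lintegral_fintype]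
  refine Finset.sum_congr rfl fun a _ => ?_
  rw [lintegral_smul_measure, lintegral_map hF (by fun_prop), actionLaw,
    Measure.lintegral_compProd (by fun_prop), Measure.map_apply hf (measurableSet_singleton a),
    mul_comm]
  rfl

/-- Here the action is a function of the parameter, so each action restricts the parameter to an
event. In `sampledLaw_eq_sum` the action is independent of the parameter, so each action only
contributes a weight. The regret is the difference between restricting and weighting. -/
theorem informedLaw_eq_sum : informedLaw π hf ρ =
    ∑ a, ((actionLaw π ρ a).restrict (Prod.fst ⁻¹' (f ⁻¹' {a}))).map Prod.snd := by
  classical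
  refine Measure.ext_of_lintegral _ fun F hF => ?_
  have hs : ∀ a, MeasurableSet (f ⁻¹' {a}) := fun a => hf (measurableSet_singleton a)
  rw [lintegral_finsetSum_measure, informedLaw, Measure.lintegral_bind (Kernel.aemeasurable _)
    hF.aemeasurable]
  have : ∀ a, ∫⁻ r, F r ∂(((actionLaw π ρ a).restrict (Prod.fst ⁻¹' (f ⁻¹' {a}))).map Prod.snd)
      = ∫⁻ θ, (f ⁻¹' {a}).indicator (fun θ => ∫⁻ r, F r ∂(ρ (θ, a))) θ ∂π := by
    intro a
    rw [lintegral_map hF measurable_snd, lintegral_indicator (hs a), actionLaw,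
      ← Set.prod_univ, Measure.setLIntegral_compProd (by fun_prop) (hs a) MeasurableSet.univ]
    simp
  simp_rw [this]
  rw [← lintegral_finsetSum]
  · refine lintegral_congr fun θ => ?_
    rw [Finset.sum_eq_single (f θ)]
    · simp
    · intro b _ hb
      simp [Set.indicator, hb.symm]
    · simp
  · intro a _
    exact Measurable.indicator (by
      have : Measurable fun θ : 𝒪 => (θ, a) := by fun_prop
      exact (hF.lintegral_kernel (κ := ρ)).comp this) (hs a)

end OneRound

/-! ### The score of one round: exponential moment, mean and integrability. -/

section OneRound

variable {𝒜 𝒪 : Type*} [MeasurableSpace 𝒜] [MeasurableSpace 𝒪]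

open Classical in
/-- The exponent of the Donsker-Varadhan test function of one round: when the sampled action agrees
with `b`, the rescaled deviation of the reward from its mean, less its log moment bound. -/
noncomputable def score (v : ℝ≥0) (lam p m : ℝ) (b a : 𝒜) (r : ℝ) : ℝ :=
  if b = a then lam / p * (r - m) - v * (lam / p) ^ 2 / 2 else 0

/-- The mean reward of the action `a`. -/
noncomputable def meanReward (π : Measure 𝒪) (ρ : Kernel (𝒪 × 𝒜) ℝ) (a : 𝒜) : ℝ :=
  ∫ r, r ∂((ρ.comap (fun θ => (θ, a)) (by fun_prop)) ∘ₘ π)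

variable (π : Measure 𝒪) [IsProbabilityMeasure π] {f : 𝒪 → 𝒜} (hf : Measurable f)
  (ρ : Kernel (𝒪 × 𝒜) ℝ) [IsMarkovKernel ρ] [Fintype 𝒜] [MeasurableSingletonClass 𝒜]

include hf in
-- Actions of probability zero are exempt because sub-Gaussianity is only available for actions that
-- can be played; their terms carry weight zero.
theorem integrable_sampledLaw {F : (𝒪 × 𝒜) × ℝ → ℝ} (hF : Measurable F)
    (h : ∀ a, π (f ⁻¹' {a}) ≠ 0 → Integrable (fun q => F ((q.1, a), q.2)) (actionLaw π ρ a)) :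
    Integrable F (sampledLaw π f ρ) := by
  rw [sampledLaw_eq_sum π hf ρ, integrable_finsetSum_measure]
  intro a _
  by_cases ha : π (f ⁻¹' {a}) = 0
  · simp [ha]
  · exact ((integrable_map_measure hF.aestronglyMeasurable (by fun_prop)).2
      (h a ha)).smul_measure (measure_ne_top _ _)

include hf in
theorem integral_sampledLaw {F : (𝒪 × 𝒜) × ℝ → ℝ} (hF : Measurable F)
    (h : ∀ a, π (f ⁻¹' {a}) ≠ 0 → Integrable (fun q => F ((q.1, a), q.2)) (actionLaw π ρ a)) :
    ∫ z, F z ∂(sampledLaw π f ρ) =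
      ∑ a, π.real (f ⁻¹' {a}) * ∫ q, F ((q.1, a), q.2) ∂(actionLaw π ρ a) := by
  have hi := integrable_sampledLaw π hf ρ hF h
  rw [sampledLaw_eq_sum π hf ρ] at hi ⊢
  rw [integral_finsetSum_measure (integrable_finsetSum_measure.1 hi)]
  refine Finset.sum_congr rfl fun a _ => ?_
  rw [integral_smul_measure, integral_map (by fun_prop) hF.aestronglyMeasurable]
  rfl

theorem integrable_informedLaw {F : ℝ → ℝ} (hF : Measurable F)
    (h : ∀ a, π (f ⁻¹' {a}) ≠ 0 → Integrable (fun q => F q.2) (actionLaw π ρ a)) :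
    Integrable F (informedLaw π hf ρ) := by
  rw [informedLaw_eq_sum, integrable_finsetSum_measure]
  intro a _
  by_cases ha : π (f ⁻¹' {a}) = 0
  · rw [Measure.restrict_eq_zero.2]
    · simp
    · rwa [actionLaw_preimage _ _ _ (hf (measurableSet_singleton a))]
  · exact (integrable_map_measure hF.aestronglyMeasurable (by fun_prop)).2 (h a ha).restrict

theorem integral_informedLaw {F : ℝ → ℝ} (hF : Measurable F)
    (h : ∀ a, π (f ⁻¹' {a}) ≠ 0 → Integrable (fun q => F q.2) (actionLaw π ρ a)) :
    ∫ r, F r ∂(informedLaw π hf ρ) =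
      ∑ a, ∫ q in Prod.fst ⁻¹' (f ⁻¹' {a}), F q.2 ∂(actionLaw π ρ a) := by
  have hi := integrable_informedLaw π hf ρ hF h
  rw [informedLaw_eq_sum] at hi ⊢
  rw [integral_finsetSum_measure (integrable_finsetSum_measure.1 hi)]
  refine Finset.sum_congr rfl fun a _ => ?_
  rw [integral_map (by fun_prop) hF.aestronglyMeasurable]

/-- The score of a triple of parameter, action and reward. -/
noncomputable def roundScore (v : ℝ≥0) (lam : ℝ) (f : 𝒪 → 𝒜) (z : (𝒪 × 𝒜) × ℝ) : ℝ :=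
  score v lam (π.real (f ⁻¹' {z.1.2})) (meanReward π ρ z.1.2) (f z.1.1) z.1.2 z.2

omit [IsProbabilityMeasure π] [IsMarkovKernel ρ] in
include hf in
theorem measurable_roundScore (v : ℝ≥0) (lam : ℝ) : Measurable (roundScore π ρ v lam f) := by
  unfold roundScore score
  have h1 : Measurable fun z : (𝒪 × 𝒜) × ℝ => π.real (f ⁻¹' {z.1.2}) :=
    (measurable_of_finite fun a : 𝒜 => π.real (f ⁻¹' {a})).comp (by fun_prop)
  have h2 : Measurable fun z : (𝒪 × 𝒜) × ℝ => meanReward π ρ z.1.2 :=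
    (measurable_of_finite fun a : 𝒜 => meanReward π ρ a).comp (by fun_prop)
  refine Measurable.ite ?_ ?_ measurable_const
  · exact measurableSet_eq_fun (by fun_prop) (by fun_prop)
  · fun_prop

variable {π ρ} {v : ℝ≥0}

omit [Fintype 𝒜] [MeasurableSingletonClass 𝒜] in
theorem integrable_actionLaw_of_subGaussian {a : 𝒜}
    (h : IsSubGaussianLaw v ((ρ.comap (fun θ => (θ, a)) (by fun_prop)) ∘ₘ π)) :
    Integrable (fun q => q.2) (actionLaw π ρ a) := by
  have := h.integrable
  rw [← map_snd_actionLaw] at this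
  exact (integrable_map_measure (f := Prod.snd) (g := fun r : ℝ => r) (by fun_prop)
    (by fun_prop)).1 this

omit [Fintype 𝒜] [MeasurableSingletonClass 𝒜] in
theorem integral_actionLaw_eq (a : 𝒜) :
    ∫ q, q.2 ∂(actionLaw π ρ a) = meanReward π ρ a :=
  integral_snd_actionLaw π ρ a measurable_id

omit [Fintype 𝒜] [MeasurableSingletonClass 𝒜] in
theorem integral_abs_sub_actionLaw_le {a : 𝒜} {s : ℝ} (hs : 0 < s)
    (h : IsSubGaussianLaw v ((ρ.comap (fun θ => (θ, a)) (by fun_prop)) ∘ₘ π)) :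
    ∫ q, |q.2 - meanReward π ρ a| ∂(actionLaw π ρ a) ≤ 2 * Real.exp (v * s ^ 2 / 2) / s := by
  rw [integral_snd_actionLaw π ρ a (F := fun r => |r - meanReward π ρ a|) (by fun_prop)]
  exact h.integral_abs_sub_le hs

omit [IsProbabilityMeasure π] [IsMarkovKernel ρ] [Fintype 𝒜] [MeasurableSingletonClass 𝒜] in
theorem roundScore_apply (lam : ℝ) (a : 𝒜) (q : 𝒪 × ℝ) :
    roundScore π ρ v lam f ((q.1, a), q.2) = (Prod.fst ⁻¹' (f ⁻¹' {a})).indicator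
      (fun q : 𝒪 × ℝ => lam / π.real (f ⁻¹' {a}) * (q.2 - meanReward π ρ a)
        - v * (lam / π.real (f ⁻¹' {a})) ^ 2 / 2) q := by
  by_cases h : f q.1 = a
  · rw [Set.indicator_of_mem (by exact h)]
    simp [roundScore, score, h]
  · rw [Set.indicator_of_notMem (by exact h)]
    simp [roundScore, score, h]

include hf

/-- With the parameter frozen at `θ`, only the action `f θ` has a nonzero score. Its reward then
follows the predictive law, centred at `meanReward`, and the subtracted quadratic term is exactly
the sub-Gaussian bound on the log moment. -/
theorem lintegral_exp_roundScore_le (lam : ℝ)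
    (hS : ∀ a, π (f ⁻¹' {a}) ≠ 0 →
      IsSubGaussianLaw v ((ρ.comap (fun θ => (θ, a)) (by fun_prop)) ∘ₘ π)) (θ : 𝒪) :
    ∫⁻ z, ENNReal.ofReal (Real.exp (roundScore π ρ v lam f ((θ, z.1.2), z.2))) ∂(sampledLaw π f ρ)
      ≤ 1 := by
  have hm := measurable_roundScore π hf ρ v lam
  rw [sampledLaw_eq_sum π hf ρ, lintegral_finsetSum_measure]
  have hsum : ∑ a, π (f ⁻¹' {a}) = 1 := by
    have := Measure.isProbabilityMeasure_map (μ := π) hf.aemeasurable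
    rw [← measure_univ (μ := π.map f), ← lintegral_one, lintegral_fintype]
    exact Finset.sum_congr rfl fun a _ => by
      rw [Measure.map_apply hf (measurableSet_singleton a), one_mul]
  rw [← hsum]
  refine Finset.sum_le_sum fun a _ => ?_
  rw [lintegral_smul_measure, lintegral_map (by fun_prop) (by fun_prop)]
  by_cases ha : π (f ⁻¹' {a}) = 0
  · simp [ha]
  refine mul_le_of_le_one_right' ?_
  by_cases hfa : f θ = a
  · simp only [roundScore, score, hfa, if_true]
    rw [← lintegral_map (μ := actionLaw π ρ a) (g := Prod.snd)
      (f := fun r : ℝ => ENNReal.ofReal (Real.exp (lam / π.real (f ⁻¹' {a}) *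
      (r - meanReward π ρ a) - v * (lam / π.real (f ⁻¹' {a})) ^ 2 / 2))) (by fun_prop) (by fun_prop),
      map_snd_actionLaw]
    exact (hS a ha).lintegral_exp_le _
  · simp [roundScore, score, hfa]

variable (hS : ∀ a, π (f ⁻¹' {a}) ≠ 0 →
      IsSubGaussianLaw v ((ρ.comap (fun θ => (θ, a)) (by fun_prop)) ∘ₘ π))
include hS

theorem integrable_snd_sampledLaw : Integrable (fun z => z.2) (sampledLaw π f ρ) :=
  integrable_sampledLaw π hf ρ measurable_snd fun a ha => integrable_actionLaw_of_subGaussian (hS a ha)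

theorem integrable_roundScore (lam : ℝ) :
    Integrable (roundScore π ρ v lam f) (sampledLaw π f ρ) := by
  refine integrable_sampledLaw π hf ρ (measurable_roundScore π hf ρ v lam) fun a ha => ?_
  simp_rw [roundScore_apply]
  exact ((((integrable_actionLaw_of_subGaussian (hS a ha)).sub (integrable_const _)).const_mul
    _).sub (integrable_const _)).indicator (measurable_fst (hf (measurableSet_singleton a)))

/-- Admissibility only controls the reward of the informed player. The predictive mean links the two
players: on the event that `a` is optimal, `|m|` exceeds the informed reward by at most a deviation,
and the sampled reward exceeds `|m|` by at most another. -/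
theorem integral_abs_sampledLaw_le {s : ℝ} (hs : 0 < s) :
    ∫ z, |z.2| ∂(sampledLaw π f ρ) ≤ ∫ r, |r| ∂(informedLaw π hf ρ) +
      Fintype.card 𝒜 * (2 * (2 * Real.exp (v * s ^ 2 / 2) / s)) := by
  rw [integral_sampledLaw π hf ρ (F := fun z => |z.2|) (by fun_prop) fun a ha =>
    (integrable_actionLaw_of_subGaussian (hS a ha)).abs, integral_informedLaw π hf ρ (by fun_prop)
    fun a ha => (integrable_actionLaw_of_subGaussian (hS a ha)).abs]
  rw [← nsmul_eq_mul, ← Finset.card_univ, ← Finset.sum_const, ← Finset.sum_add_distrib]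
  refine Finset.sum_le_sum fun a _ => ?_
  set E : Set (𝒪 × ℝ) := Prod.fst ⁻¹' (f ⁻¹' {a})
  have hE : MeasurableSet E := measurable_fst (hf (measurableSet_singleton a))
  have hpE : (actionLaw π ρ a).real E = π.real (f ⁻¹' {a}) :=
    actionLaw_real_preimage _ _ _ (hf (measurableSet_singleton a))
  by_cases ha : π (f ⁻¹' {a}) = 0
  · have : π.real (f ⁻¹' {a}) = 0 := by simp [Measure.real, ha]
    rw [this, zero_mul]
    have : 0 ≤ ∫ q in E, |q.2| ∂(actionLaw π ρ a) := integral_nonneg fun _ => abs_nonneg _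
    positivity
  have hi := integrable_actionLaw_of_subGaussian (hS a ha)
  have hd : Integrable (fun q => |q.2 - meanReward π ρ a|) (actionLaw π ρ a) :=
    (hi.sub (integrable_const _)).abs
  have hD := integral_abs_sub_actionLaw_le hs (hS a ha)
  set m := meanReward π ρ a
  set D := 2 * Real.exp (v * s ^ 2 / 2) / s
  have hp0 : 0 ≤ π.real (f ⁻¹' {a}) := measureReal_nonneg
  have hp1 : π.real (f ⁻¹' {a}) ≤ 1 := measureReal_le_one
  have e1 : ∫ q, |q.2| ∂(actionLaw π ρ a) ≤ |m| + D := by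
    calc ∫ q, |q.2| ∂(actionLaw π ρ a) ≤ ∫ q, (|m| + |q.2 - m|) ∂(actionLaw π ρ a) :=
          integral_mono hi.abs ((integrable_const _).add hd) fun q => by
            have := abs_add_le m (q.2 - m)
            simpa using this
      _ ≤ _ := by
          rw [integral_add (integrable_const _) hd]
          simpa using hD
  have e2 : π.real (f ⁻¹' {a}) * |m| ≤ ∫ q in E, |q.2| ∂(actionLaw π ρ a) + D := by
    calc π.real (f ⁻¹' {a}) * |m| = ∫ q in E, |m| ∂(actionLaw π ρ a) := by
          rw [setIntegral_const, hpE, smul_eq_mul]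
      _ ≤ ∫ q in E, (|q.2| + |q.2 - m|) ∂(actionLaw π ρ a) :=
          integral_mono (integrable_const _) (hi.abs.add hd).restrict fun q => by
            have := abs_sub q.2 (q.2 - m)
            simpa using this
      _ = ∫ q in E, |q.2| ∂(actionLaw π ρ a) + ∫ q in E, |q.2 - m| ∂(actionLaw π ρ a) :=
          integral_add hi.abs.restrict hd.restrict
      _ ≤ _ := by
          gcongr
          exact (setIntegral_le_integral hd (ae_of_all _ fun _ => abs_nonneg _)).trans hD
  have hD0 : 0 ≤ D := by positivity
  nlinarith

theorem informed_sub_sampled_eq : ∫ r, r ∂(informedLaw π hf ρ) - ∫ z, z.2 ∂(sampledLaw π f ρ) =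
    ∑ a, ∫ q in Prod.fst ⁻¹' (f ⁻¹' {a}), (q.2 - meanReward π ρ a) ∂(actionLaw π ρ a) := by
  rw [integral_sampledLaw π hf ρ measurable_snd fun a ha =>
    (integrable_actionLaw_of_subGaussian (hS a ha)), integral_informedLaw π hf ρ (F := fun r => r) measurable_id
    fun a ha => (integrable_actionLaw_of_subGaussian (hS a ha)), ← Finset.sum_sub_distrib]
  refine Finset.sum_congr rfl fun a _ => ?_
  by_cases ha : π (f ⁻¹' {a}) = 0
  · have h0 : π.real (f ⁻¹' {a}) = 0 := by simp [Measure.real, ha]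
    have hE := actionLaw_preimage π ρ a (hf (measurableSet_singleton a))
    rw [ha] at hE
    simp [h0, Measure.restrict_eq_zero.2 hE]
  · have hi := integrable_actionLaw_of_subGaussian (hS a ha)
    rw [integral_sub hi.restrict (integrable_const _), setIntegral_const,
      actionLaw_real_preimage _ _ _ (hf (measurableSet_singleton a)), integral_actionLaw_eq]
    rfl

/-- A bound free of entropy, with `s` left free: for `v = 0` it tends to zero as `s` grows. -/
theorem informed_sub_sampled_le {s : ℝ} (hs : 0 < s) :
    ∫ r, r ∂(informedLaw π hf ρ) - ∫ z, z.2 ∂(sampledLaw π f ρ) ≤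
      Fintype.card 𝒜 * (2 * Real.exp (v * s ^ 2 / 2) / s) := by
  rw [informed_sub_sampled_eq hf hS, ← nsmul_eq_mul, ← Finset.card_univ, ← Finset.sum_const]
  refine Finset.sum_le_sum fun a _ => ?_
  by_cases ha : π (f ⁻¹' {a}) = 0
  · have hE := actionLaw_preimage π ρ a (hf (measurableSet_singleton a))
    rw [ha] at hE
    rw [Measure.restrict_eq_zero.2 hE, integral_zero_measure]
    positivity
  · have hd : Integrable (fun q => q.2 - meanReward π ρ a) (actionLaw π ρ a) :=
      (integrable_actionLaw_of_subGaussian (hS a ha)).sub (integrable_const _)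
    exact ((le_abs_self _).trans (abs_integral_le_integral_abs)).trans
      ((setIntegral_le_integral hd.abs (ae_of_all _ fun _ => abs_nonneg _)).trans
        (integral_abs_sub_actionLaw_le hs (hS a ha)))

theorem le_integral_roundScore (lam : ℝ) :
    lam * (∫ r, r ∂(informedLaw π hf ρ) - ∫ z, z.2 ∂(sampledLaw π f ρ)) -
      Fintype.card 𝒜 * (v * lam ^ 2 / 2) ≤ ∫ z, roundScore π ρ v lam f z ∂(sampledLaw π f ρ) := by
  have hE : ∀ a, MeasurableSet (Prod.fst ⁻¹' (f ⁻¹' {a}) : Set (𝒪 × ℝ)) := fun a =>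
    measurable_fst (hf (measurableSet_singleton a))
  rw [informed_sub_sampled_eq hf hS, integral_sampledLaw π hf ρ (measurable_roundScore π hf ρ v lam)]
  · rw [Finset.mul_sum, ← nsmul_eq_mul, ← Finset.card_univ, ← Finset.sum_const,
      ← Finset.sum_sub_distrib]
    refine Finset.sum_le_sum fun a _ => ?_
    have hE' := actionLaw_preimage π ρ a (hf (measurableSet_singleton a))
    by_cases ha : π (f ⁻¹' {a}) = 0
    · have h0 : π.real (f ⁻¹' {a}) = 0 := by simp [Measure.real, ha]
      rw [ha] at hE'
      rw [Measure.restrict_eq_zero.2 hE', integral_zero_measure, h0]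
      have : (0 : ℝ) ≤ v * lam ^ 2 / 2 := by positivity
      linarith
    · have hp : π.real (f ⁻¹' {a}) ≠ 0 := by
        simpa [Measure.real, ENNReal.toReal_eq_zero_iff] using ha
      have hd : Integrable (fun q => q.2 - meanReward π ρ a) (actionLaw π ρ a) :=
        (integrable_actionLaw_of_subGaussian (hS a ha)).sub (integrable_const _)
      simp_rw [roundScore_apply]
      rw [integral_indicator (hE a), integral_sub (hd.const_mul _).restrict (integrable_const _),
        setIntegral_const, integral_const_mul,
        actionLaw_real_preimage _ _ _ (hf (measurableSet_singleton a)), smul_eq_mul]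
      -- The action is played with probability `p` and is optimal with probability `p`; the product
      -- cancels `1 / p ^ 2` in the quadratic term, so each action costs `v * lam ^ 2 / 2` whatever
      -- its probability.
      refine le_of_eq ?_
      field_simp
  · intro a ha
    simp_rw [roundScore_apply]
    exact ((((integrable_actionLaw_of_subGaussian (hS a ha)).sub (integrable_const _)).const_mul
      _).sub (integrable_const _)).indicator (hE a)

/-- The bound does not involve the action probabilities, although the score divides by them; it is
therefore uniform in history and context and yields integrability of the score over a whole round.
-/
theorem integral_abs_roundScore_le (lam : ℝ) {s : ℝ} (hs : 0 < s) :
    ∫ z, |roundScore π ρ v lam f z| ∂(sampledLaw π f ρ) ≤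
      Fintype.card 𝒜 * (|lam| * (2 * Real.exp (v * s ^ 2 / 2) / s) + v * lam ^ 2 / 2) := by
  have hE : ∀ a, MeasurableSet (Prod.fst ⁻¹' (f ⁻¹' {a}) : Set (𝒪 × ℝ)) := fun a =>
    measurable_fst (hf (measurableSet_singleton a))
  have hI : ∀ a, π (f ⁻¹' {a}) ≠ 0 →
      Integrable (fun q => roundScore π ρ v lam f ((q.1, a), q.2)) (actionLaw π ρ a) := by
    intro a ha
    simp_rw [roundScore_apply]
    exact ((((integrable_actionLaw_of_subGaussian (hS a ha)).sub (integrable_const _)).const_mul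
      _).sub (integrable_const _)).indicator (hE a)
  rw [integral_sampledLaw π hf ρ (F := fun z => |roundScore π ρ v lam f z|)
    (measurable_roundScore π hf ρ v lam).abs fun a ha => (hI a ha).abs]
  rw [← nsmul_eq_mul, ← Finset.card_univ, ← Finset.sum_const]
  refine Finset.sum_le_sum fun a _ => ?_
  by_cases ha : π (f ⁻¹' {a}) = 0
  · have h0 : π.real (f ⁻¹' {a}) = 0 := by simp [Measure.real, ha]
    rw [h0, zero_mul]
    positivity
  have hp : 0 < π.real (f ⁻¹' {a}) := ENNReal.toReal_pos ha (measure_ne_top _ _)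
  have hd : Integrable (fun q => q.2 - meanReward π ρ a) (actionLaw π ρ a) :=
    (integrable_actionLaw_of_subGaussian (hS a ha)).sub (integrable_const _)
  have hD := integral_abs_sub_actionLaw_le hs (hS a ha)
  set D := 2 * Real.exp (v * s ^ 2 / 2) / s
  set p := π.real (f ⁻¹' {a})
  set m := meanReward π ρ a
  calc p * ∫ q, |roundScore π ρ v lam f ((q.1, a), q.2)| ∂(actionLaw π ρ a)
      ≤ p * ∫ q, (|lam| / p * |q.2 - m| + (Prod.fst ⁻¹' (f ⁻¹' {a})).indicator
          (fun _ => v * (lam / p) ^ 2 / 2) q) ∂(actionLaw π ρ a) := by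
        gcongr
        · exact (hI a ha).abs
        · exact (hd.abs.const_mul _).add ((integrable_const _).indicator (hE a))
        · intro q
          beta_reduce
          rw [roundScore_apply]
          by_cases hq : q ∈ (Prod.fst ⁻¹' (f ⁻¹' {a}) : Set (𝒪 × ℝ))
          · rw [Set.indicator_of_mem hq, Set.indicator_of_mem hq]
            refine (abs_sub _ _).trans ?_
            rw [abs_mul, abs_div, abs_of_pos hp]
            gcongr
            exact (abs_of_nonneg (by positivity)).le
          · rw [Set.indicator_of_notMem hq, Set.indicator_of_notMem hq, abs_zero, add_zero]
            positivity
    _ = |lam| * ∫ q, |q.2 - m| ∂(actionLaw π ρ a) + v * lam ^ 2 / 2 := by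
        rw [integral_add (hd.abs.const_mul _) ((integrable_const _).indicator (hE a)),
          integral_indicator (hE a), setIntegral_const, integral_const_mul,
          actionLaw_real_preimage _ _ _ (hf (measurableSet_singleton a)), smul_eq_mul]
        change p * (|lam| / p * ∫ q, |q.2 - m| ∂(actionLaw π ρ a) + p * _) = _
        field_simp
    _ ≤ _ := by gcongr

end OneRound

/-! ### Kernels and joint laws of a round of Thompson Sampling. -/

namespace ContextualBandit

variable {𝒳 𝒜 𝒪 : Type*} [MeasurableSpace 𝒳] [MeasurableSpace 𝒜] [MeasurableSpace 𝒪]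
  [StandardBorelSpace 𝒪] [Nonempty 𝒪]

section Kernels

variable (Φ : ContextualBandit 𝒳 𝒜 𝒪) (ψ : DecisionRule 𝒳 𝒜 𝒪) (t : ℕ)

/-- The rewards for a given context, as a kernel from parameters and actions. -/
noncomputable def rewardAt (x : 𝒳) : Kernel (𝒪 × 𝒜) ℝ :=
  Φ.reward.comap (fun q : 𝒪 × 𝒜 => (x, q.2, q.1)) (by fun_prop)

instance (x : 𝒳) : IsMarkovKernel (Φ.rewardAt x) := by unfold rewardAt; infer_instance

omit [StandardBorelSpace 𝒪] [Nonempty 𝒪] in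
theorem measurable_decision (x : 𝒳) : Measurable fun θ => ψ.1 (x, θ) :=
  ψ.2.comp (by fun_prop)

/-- The law of the history of the first `t` rounds. -/
noncomputable def historyLaw : Measure (BanditHistory 𝒳 𝒜 t) := Φ.tsHistory ψ t ∘ₘ Φ.prior

instance : IsProbabilityMeasure (Φ.historyLaw ψ t) := by unfold historyLaw; infer_instance

/-- The joint law of the parameter and of the history of the first `t` rounds. -/
noncomputable def jointLaw : Measure (𝒪 × BanditHistory 𝒳 𝒜 t) := Φ.prior ⊗ₘ Φ.tsHistory ψ t

instance : IsProbabilityMeasure (Φ.jointLaw ψ t) := by unfold jointLaw; infer_instance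

theorem map_snd_jointLaw : (Φ.jointLaw ψ t).map Prod.snd = Φ.historyLaw ψ t :=
  Measure.snd_compProd _ _

/-- Bayes' rule: the joint law, built from the prior, is disintegrated along the history instead. -/
theorem lintegral_jointLaw {F : 𝒪 × BanditHistory 𝒳 𝒜 t → ℝ≥0∞} (hF : Measurable F) :
    ∫⁻ q, F q ∂(Φ.jointLaw ψ t) =
      ∫⁻ h, ∫⁻ θ, F (θ, h) ∂(Φ.tsPosterior ψ t h) ∂(Φ.historyLaw ψ t) := by
  have h := compProd_posterior_eq_map_swap (κ := Φ.tsHistory ψ t) (μ := Φ.prior)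
  have h2 : Φ.jointLaw ψ t = (Φ.historyLaw ψ t ⊗ₘ Φ.tsPosterior ψ t).map Prod.swap := by
    rw [historyLaw, tsPosterior, h, Measure.map_map measurable_swap measurable_swap]
    simp [jointLaw]
  rw [h2, lintegral_map hF measurable_swap, Measure.lintegral_compProd (by fun_prop)]
  rfl

/-- The posterior, as a kernel that ignores the context. -/
noncomputable def contextPosterior : Kernel (BanditHistory 𝒳 𝒜 t × 𝒳) 𝒪 :=
  (Φ.tsPosterior ψ t).comap Prod.fst measurable_fst

instance : IsMarkovKernel (Φ.contextPosterior ψ t) := by unfold contextPosterior; infer_instance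

/-- The law of the action that Thompson Sampling takes, given the history and the context. -/
noncomputable def actionKernel : Kernel (BanditHistory 𝒳 𝒜 t × 𝒳) 𝒜 :=
  (Kernel.id ×ₖ Φ.contextPosterior ψ t).map fun q => ψ.1 (q.1.2, q.2)

omit [StandardBorelSpace 𝒪] [Nonempty 𝒪] in
omit [StandardBorelSpace 𝒪] [Nonempty 𝒪] in
theorem measurable_decision_prod :
    Measurable fun q : (BanditHistory 𝒳 𝒜 t × 𝒳) × 𝒪 => ψ.1 (q.1.2, q.2) :=
  ψ.2.comp (by fun_prop)

instance : IsMarkovKernel (Φ.actionKernel ψ t) :=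
  Kernel.IsMarkovKernel.map _ (measurable_decision_prod ψ t)

theorem actionKernel_apply (c : BanditHistory 𝒳 𝒜 t × 𝒳) :
    Φ.actionKernel ψ t c = (Φ.tsPosterior ψ t c.1).map fun θ => ψ.1 (c.2, θ) := by
  rw [actionKernel, Kernel.map_apply _ (measurable_decision_prod ψ t), Kernel.prod_apply,
    Kernel.id_apply, Measure.dirac_prod, Measure.map_map (measurable_decision_prod ψ t) (by fun_prop)]
  rfl

/-- The conditional law of the parameter, the action and the reward in a round of Thompson Sampling,
given the history and the context. -/
noncomputable def roundKernel : Kernel (BanditHistory 𝒳 𝒜 t × 𝒳) ((𝒪 × 𝒜) × ℝ) :=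
  (Φ.contextPosterior ψ t ×ₖ Φ.actionKernel ψ t) ⊗ₖ
    Φ.reward.comap (fun q : (BanditHistory 𝒳 𝒜 t × 𝒳) × (𝒪 × 𝒜) => (q.1.2, q.2.2, q.2.1))
      (by fun_prop)

instance : IsMarkovKernel (Φ.roundKernel ψ t) := by unfold roundKernel; infer_instance

theorem roundKernel_apply (c : BanditHistory 𝒳 𝒜 t × 𝒳) :
    Φ.roundKernel ψ t c =
      sampledLaw (Φ.tsPosterior ψ t c.1) (fun θ => ψ.1 (c.2, θ)) (Φ.rewardAt c.2) := by
  rw [roundKernel, Kernel.compProd_apply_eq_compProd_sectR, Kernel.prod_apply, actionKernel_apply]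
  rfl

/-- The conditional law of the reward of a player who knows the parameter, given the history and the
context. -/
noncomputable def informedKernel : Kernel (BanditHistory 𝒳 𝒜 t × 𝒳) ℝ :=
  (Φ.contextPosterior ψ t ⊗ₖ Φ.reward.comap
    (fun q : (BanditHistory 𝒳 𝒜 t × 𝒳) × 𝒪 => (q.1.2, ψ.1 (q.1.2, q.2), q.2))
    ((measurable_snd.comp measurable_fst).prodMk
      ((measurable_decision_prod ψ t).prodMk measurable_snd))).map Prod.snd

instance : IsMarkovKernel (Φ.informedKernel ψ t) := Kernel.IsMarkovKernel.map _ measurable_snd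

theorem informedKernel_apply (c : BanditHistory 𝒳 𝒜 t × 𝒳) :
    Φ.informedKernel ψ t c =
      informedLaw (Φ.tsPosterior ψ t c.1) (measurable_decision ψ c.2) (Φ.rewardAt c.2) := by
  rw [informedKernel, Kernel.map_apply _ measurable_snd, Kernel.compProd_apply_eq_compProd_sectR]
  exact Measure.snd_compProd _ _

/-- The law of the history and of the next context. -/
noncomputable def contextLaw : Measure (BanditHistory 𝒳 𝒜 t × 𝒳) :=
  (Φ.historyLaw ψ t).prod Φ.context

instance : IsProbabilityMeasure (Φ.contextLaw ψ t) := by unfold contextLaw; infer_instance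

/-- The joint law of the history, the next context, the parameter, the action and the reward. -/
noncomputable def roundLaw : Measure ((BanditHistory 𝒳 𝒜 t × 𝒳) × ((𝒪 × 𝒜) × ℝ)) :=
  Φ.contextLaw ψ t ⊗ₘ Φ.roundKernel ψ t

instance : IsProbabilityMeasure (Φ.roundLaw ψ t) := by unfold roundLaw; infer_instance

/-- The next context is independent of the history and the posterior averages to the prior, so
conditioning on the history does not change the mean reward of the informed player. -/
theorem informedKernel_comp : Φ.informedKernel ψ t ∘ₘ Φ.contextLaw ψ t = Φ.ruleRewardLaw ψ := by
  refine Measure.ext_of_lintegral _ fun F hF => ?_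
  have hψ : Measurable fun q : 𝒳 × 𝒪 => (q.1, ψ.1 q, q.2) :=
    measurable_fst.prodMk (ψ.2.prodMk measurable_snd)
  have hG : Measurable fun q : 𝒳 × 𝒪 => ∫⁻ r, F r ∂(Φ.reward (q.1, ψ.1 q, q.2)) :=
    (hF.lintegral_kernel (κ := Φ.reward)).comp hψ
  rw [Measure.lintegral_bind (Kernel.aemeasurable _) hF.aemeasurable, contextLaw,
    lintegral_prod_symm _ (hF.lintegral_kernel).aemeasurable, ruleRewardLaw,
    Measure.lintegral_bind (Kernel.aemeasurable _) hF.aemeasurable,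
    lintegral_prod _ (by exact hG.aemeasurable)]
  refine lintegral_congr fun x => ?_
  have hp : Φ.prior = Φ.tsPosterior ψ t ∘ₘ Φ.historyLaw ψ t := posterior_comp_self.symm
  conv_rhs => rw [hp]
  have hx : Measurable fun θ => ∫⁻ r, F r ∂(Φ.reward (x, ψ.1 (x, θ), θ)) :=
    hG.comp (measurable_prodMk_left (x := x))
  rw [Measure.lintegral_bind (Kernel.aemeasurable _) (by exact hx.aemeasurable)]
  refine lintegral_congr fun h => ?_
  rw [informedKernel_apply, informedLaw,
    Measure.lintegral_bind (Kernel.aemeasurable _) hF.aemeasurable]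
  rfl

/-- Puts the integrals in the generative order of `tsRound`, with the parameter before the context,
so that the two descriptions of a round can be matched. -/
theorem lintegral_roundLaw {F : (BanditHistory 𝒳 𝒜 t × 𝒳) × ((𝒪 × 𝒜) × ℝ) → ℝ≥0∞}
    (hF : Measurable F) : ∫⁻ z, F z ∂(Φ.roundLaw ψ t) =
      ∫⁻ h, ∫⁻ θ, ∫⁻ x, ∫⁻ θ', ∫⁻ r, F ((h, x), ((θ, ψ.1 (x, θ')), r))
        ∂(Φ.reward (x, ψ.1 (x, θ'), θ)) ∂(Φ.tsPosterior ψ t h) ∂Φ.context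
        ∂(Φ.tsPosterior ψ t h) ∂(Φ.historyLaw ψ t) := by
  rw [roundLaw, Measure.lintegral_compProd hF, contextLaw,
    lintegral_prod _ (hF.lintegral_kernel_prod_right').aemeasurable]
  refine lintegral_congr fun h => ?_
  have hG : Measurable fun q : ((𝒪 × 𝒳) × 𝒪) =>
      ∫⁻ r, F ((h, q.1.2), ((q.1.1, ψ.1 (q.1.2, q.2)), r))
        ∂(Φ.reward (q.1.2, ψ.1 (q.1.2, q.2), q.1.1)) := by
    have h1 : Measurable fun q : (𝒪 × 𝒳) × 𝒪 => ψ.1 (q.1.2, q.2) := ψ.2.comp (by fun_prop)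
    have h2 : Measurable fun q : (𝒪 × 𝒳) × 𝒪 => (q.1.2, ψ.1 (q.1.2, q.2), q.1.1) :=
      (measurable_snd.comp measurable_fst).prodMk (h1.prodMk (measurable_fst.comp measurable_fst))
    exact Measurable.lintegral_kernel_prod_right' (κ := Φ.reward.comap _ h2)
      (f := fun q => F ((h, q.1.1.2), ((q.1.1.1, ψ.1 (q.1.1.2, q.1.2)), q.2))) (by
        have h3 : Measurable fun q : ((𝒪 × 𝒳) × 𝒪) × ℝ => q.1.1.1 := by fun_prop
        have h4 : Measurable fun q : ((𝒪 × 𝒳) × 𝒪) × ℝ => (h, q.1.1.2) := by fun_prop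
        exact hF.comp (h4.prodMk ((h3.prodMk (h1.comp measurable_fst)).prodMk measurable_snd)))
  have hG2 : Measurable fun q : 𝒪 × 𝒳 => ∫⁻ θ',
      ∫⁻ r, F ((h, q.2), ((q.1, ψ.1 (q.2, θ')), r))
        ∂(Φ.reward (q.2, ψ.1 (q.2, θ'), q.1)) ∂(Φ.tsPosterior ψ t h) :=
    hG.lintegral_prod_right'
  -- Given the history, the parameter and the next context are independent.
  rw [lintegral_lintegral_swap hG2.aemeasurable]
  refine lintegral_congr fun x => ?_
  have hx := measurable_decision ψ x
  have := Measure.isProbabilityMeasure_map (μ := Φ.tsPosterior ψ t h) hx.aemeasurable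
  have hFx : Measurable fun z : (𝒪 × 𝒜) × ℝ => F ((h, x), z) := by fun_prop
  rw [roundKernel_apply, sampledLaw, Measure.lintegral_compProd hFx,
    lintegral_prod _ (hFx.lintegral_kernel_prod_right').aemeasurable]
  refine lintegral_congr fun θ => ?_
  have hFθ : Measurable fun a => ∫⁻ r, F ((h, x), ((θ, a), r)) ∂(Φ.rewardAt x (θ, a)) :=
    (hFx.lintegral_kernel_prod_right').comp measurable_prodMk_left
  rw [lintegral_map hFθ hx]
  rfl

theorem jointLaw_eq_map : Φ.jointLaw ψ t = (Φ.roundLaw ψ t).map fun z => (z.2.1.1, z.1.1) := by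
  refine Measure.ext_of_lintegral _ fun F hF => ?_
  rw [lintegral_map hF (by fun_prop), lintegral_roundLaw Φ ψ t (by fun_prop),
    lintegral_jointLaw Φ ψ t hF]
  simp

/-- The history after one more round. -/
def nextHistory {𝒳 𝒜 𝒪 : Type*} {t : ℕ} (z : (BanditHistory 𝒳 𝒜 t × 𝒳) × ((𝒪 × 𝒜) × ℝ)) :
    BanditHistory 𝒳 𝒜 (t + 1) :=
  Fin.snoc z.1.1 (z.2.1.2, z.1.2, z.2.2)

omit [StandardBorelSpace 𝒪] [Nonempty 𝒪] in
theorem measurable_nextHistory : Measurable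
    fun z : (BanditHistory 𝒳 𝒜 t × 𝒳) × ((𝒪 × 𝒜) × ℝ) => nextHistory z := by
  have h : Measurable fun z : (BanditHistory 𝒳 𝒜 t × 𝒳) × ((𝒪 × 𝒜) × ℝ) =>
      (z.1.1, (z.2.1.2, z.1.2, z.2.2)) := by fun_prop
  exact (measurable_history_snoc t).comp h

theorem lintegral_tsRound (θ : 𝒪) (h : BanditHistory 𝒳 𝒜 t) {F : 𝒜 × 𝒳 × ℝ → ℝ≥0∞}
    (hF : Measurable F) : ∫⁻ y, F y ∂(Φ.tsRound ψ (Φ.tsPosterior ψ t) (θ, h)) =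
      ∫⁻ x, ∫⁻ θ', ∫⁻ r, F (ψ.1 (x, θ'), x, r) ∂(Φ.reward (x, ψ.1 (x, θ'), θ))
        ∂(Φ.tsPosterior ψ t h) ∂Φ.context := by
  have hm : Measurable fun w : (𝒳 × 𝒪) × ℝ => (ψ.1 w.1, w.1.1, w.2) :=
    (ψ.2.comp measurable_fst).prodMk ((measurable_fst.comp measurable_fst).prodMk measurable_snd)
  have hFm : Measurable fun w : (𝒳 × 𝒪) × ℝ => F (ψ.1 w.1, w.1.1, w.2) := hF.comp hm
  rw [tsRound, Kernel.map_apply _ hm, lintegral_map hF hm,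
    Kernel.compProd_apply_eq_compProd_sectR, Measure.lintegral_compProd hFm,
    Kernel.prod_apply, lintegral_prod]
  · rfl
  · exact (Measurable.lintegral_kernel_prod_right' hFm).aemeasurable

/-- Links the recursion that defines the history to `roundLaw`, where parameter and action are
conditionally independent given history and context. Together with `jointLaw_eq_map` it puts two
consecutive times on one probability space. -/
theorem jointLaw_succ_eq_map : Φ.jointLaw ψ (t + 1) =
    (Φ.roundLaw ψ t).map fun z => (z.2.1.1, nextHistory z) := by
  refine Measure.ext_of_lintegral _ fun F hF => ?_
  have hn := measurable_nextHistory (𝒳 := 𝒳) (𝒜 := 𝒜) (𝒪 := 𝒪) t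
  have hs := measurable_history_snoc (𝒳 := 𝒳) (𝒜 := 𝒜) t
  have hG : Measurable fun q : 𝒪 × BanditHistory 𝒳 𝒜 t × 𝒜 × 𝒳 × ℝ =>
      F (q.1, (Fin.snoc q.2.1 q.2.2 : BanditHistory 𝒳 𝒜 (t + 1))) :=
    hF.comp (measurable_fst.prodMk (hs.comp measurable_snd))
  rw [lintegral_map hF (by fun_prop), lintegral_roundLaw Φ ψ t (by fun_prop)]
  have h1 : ∫⁻ q, F q ∂(Φ.jointLaw ψ (t + 1)) = ∫⁻ q, ∫⁻ y, F (q.1, Fin.snoc q.2 y)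
      ∂(Φ.tsRound ψ (Φ.tsPosterior ψ t) q) ∂(Φ.jointLaw ψ t) := by
    rw [jointLaw, jointLaw, Measure.lintegral_compProd hF, Measure.lintegral_compProd]
    · refine lintegral_congr fun θ => ?_
      rw [tsHistory_succ, Kernel.map_apply _ hs, lintegral_map (by fun_prop) hs,
        Kernel.lintegral_compProd _ _ _ (by exact hG.comp (measurable_prodMk_left (x := θ)))]
    · exact Measurable.lintegral_kernel_prod_right'
        (f := fun p : (𝒪 × BanditHistory 𝒳 𝒜 t) × (𝒜 × 𝒳 × ℝ) => F (p.1.1, Fin.snoc p.1.2 p.2))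
        (hG.comp (f := fun p : (𝒪 × BanditHistory 𝒳 𝒜 t) × (𝒜 × 𝒳 × ℝ) => (p.1.1, p.1.2, p.2))
          (by fun_prop))
  rw [h1, lintegral_jointLaw]
  · refine lintegral_congr fun h => lintegral_congr fun θ => ?_
    rw [lintegral_tsRound Φ ψ t θ h (F := fun y => F (θ, Fin.snoc h y))
      (hG.comp (f := fun y => (θ, h, y)) (by fun_prop))]
    rfl
  · exact Measurable.lintegral_kernel_prod_right'
        (f := fun p : (𝒪 × BanditHistory 𝒳 𝒜 t) × (𝒜 × 𝒳 × ℝ) => F (p.1.1, Fin.snoc p.1.2 p.2))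
        (hG.comp (f := fun p : (𝒪 × BanditHistory 𝒳 𝒜 t) × (𝒜 × 𝒳 × ℝ) => (p.1.1, p.1.2, p.2))
          (by fun_prop))

theorem historyLaw_eq_map : Φ.historyLaw ψ t = (Φ.roundLaw ψ t).map fun z => z.1.1 := by
  rw [← map_snd_jointLaw, jointLaw_eq_map, Measure.map_map measurable_snd (by fun_prop)]
  rfl

theorem historyLaw_succ_eq_map :
    Φ.historyLaw ψ (t + 1) = (Φ.roundLaw ψ t).map nextHistory := by
  have hn := measurable_nextHistory (𝒳 := 𝒳) (𝒜 := 𝒜) (𝒪 := 𝒪) t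
  rw [← map_snd_jointLaw, jointLaw_succ_eq_map, Measure.map_map measurable_snd (by fun_prop)]
  rfl

end Kernels

end ContextualBandit

/-! ### Integrals against composed measures. -/

theorem MeasureTheory.Integrable.integral_measure_compProd {α β : Type*} [MeasurableSpace α]
    [MeasurableSpace β] {μ : Measure α} [SFinite μ] {κ : Kernel α β} [IsSFiniteKernel κ]
    {f : α × β → ℝ} (hf : Integrable f (μ ⊗ₘ κ)) : Integrable (fun x => ∫ y, f (x, y) ∂(κ x)) μ :=
  Integrable.integral_compProd (κ := Kernel.const Unit μ) (η := Kernel.prodMkLeft Unit κ)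
    (a := ()) hf

theorem MeasureTheory.Integrable.integral_measure_comp {α β : Type*} [MeasurableSpace α]
    [MeasurableSpace β] {μ : Measure α} {κ : Kernel α β} {f : β → ℝ}
    (hf : Integrable f (κ ∘ₘ μ)) : Integrable (fun x => ∫ y, f y ∂(κ x)) μ := by
  rw [Measure.comp_eq_comp_const_apply] at hf
  exact hf.integral_comp

theorem MeasureTheory.Measure.integral_comp_eq {α β : Type*} [MeasurableSpace α]
    [MeasurableSpace β] {μ : Measure α} {κ : Kernel α β} {f : β → ℝ}
    (hf : Integrable f (κ ∘ₘ μ)) : ∫ y, f y ∂(κ ∘ₘ μ) = ∫ x, ∫ y, f y ∂(κ x) ∂μ := by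
  rw [Measure.comp_eq_comp_const_apply] at hf ⊢
  exact Kernel.integral_comp hf

/-! ### One round averaged over history and context. -/

namespace ContextualBandit

variable {𝒳 𝒜 𝒪 : Type*} [MeasurableSpace 𝒳] [MeasurableSpace 𝒜] [MeasurableSpace 𝒪]
  [StandardBorelSpace 𝒪] [Nonempty 𝒪]

section Round

variable (Φ : ContextualBandit 𝒳 𝒜 𝒪) (ψ : DecisionRule 𝒳 𝒜 𝒪) (t : ℕ) (v : ℝ≥0) (lam : ℝ)

/-- The score of a round of Thompson Sampling. -/
noncomputable def tsScore (z : (BanditHistory 𝒳 𝒜 t × 𝒳) × ((𝒪 × 𝒜) × ℝ)) : ℝ :=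
  roundScore (Φ.tsPosterior ψ t z.1.1) (Φ.rewardAt z.1.2) v lam (fun θ => ψ.1 (z.1.2, θ)) z.2

variable [Fintype 𝒜] [MeasurableSingletonClass 𝒜]

theorem measurable_actionProb : Measurable fun q : 𝒜 × (BanditHistory 𝒳 𝒜 t × 𝒳) =>
    (Φ.tsPosterior ψ t q.2.1).real ((fun θ => ψ.1 (q.2.2, θ)) ⁻¹' {q.1}) := by
  refine measurable_from_prod_countable_right fun a => ?_
  exact (Kernel.measurable_kernel_prodMk_left (κ := Φ.contextPosterior ψ t)
    (t := (fun q : (BanditHistory 𝒳 𝒜 t × 𝒳) × 𝒪 => ψ.1 (q.1.2, q.2)) ⁻¹' {a})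
    (measurable_decision_prod ψ t (measurableSet_singleton a))).ennreal_toReal

theorem measurable_meanReward : Measurable fun q : 𝒜 × (BanditHistory 𝒳 𝒜 t × 𝒳) =>
    meanReward (Φ.tsPosterior ψ t q.2.1) (Φ.rewardAt q.2.2) q.1 := by
  refine measurable_from_prod_countable_right fun a => ?_
  have h : Measurable fun q : (BanditHistory 𝒳 𝒜 t × 𝒳) × 𝒪 => (q.1.2, a, q.2) := by fun_prop
  have hm : StronglyMeasurable fun c => ∫ r, r ∂((Φ.contextPosterior ψ t ⊗ₖ
      Φ.reward.comap _ h).map Prod.snd c) :=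
    StronglyMeasurable.integral_kernel (f := fun r : ℝ => r) measurable_id.stronglyMeasurable
  convert hm.measurable using 2 with c
  rw [Kernel.map_apply _ measurable_snd, Kernel.compProd_apply_eq_compProd_sectR]
  exact congrArg (fun μ : Measure ℝ => ∫ r, r ∂μ) (Measure.snd_compProd _ _).symm

theorem measurable_tsScore : Measurable (tsScore Φ ψ t v lam) := by
  have h1 := (measurable_actionProb Φ ψ t).comp
    (g := fun q : 𝒜 × (BanditHistory 𝒳 𝒜 t × 𝒳) => _)
    (f := fun z : (BanditHistory 𝒳 𝒜 t × 𝒳) × ((𝒪 × 𝒜) × ℝ) => (z.2.1.2, z.1)) (by fun_prop)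
  have h2 := (measurable_meanReward Φ ψ t).comp
    (g := fun q : 𝒜 × (BanditHistory 𝒳 𝒜 t × 𝒳) => _)
    (f := fun z : (BanditHistory 𝒳 𝒜 t × 𝒳) × ((𝒪 × 𝒜) × ℝ) => (z.2.1.2, z.1)) (by fun_prop)
  have h3 : Measurable fun z : (BanditHistory 𝒳 𝒜 t × 𝒳) × ((𝒪 × 𝒜) × ℝ) =>
      ψ.1 (z.1.2, z.2.1.1) := ψ.2.comp (by fun_prop)
  have h4 : Measurable fun z : (BanditHistory 𝒳 𝒜 t × 𝒳) × ((𝒪 × 𝒜) × ℝ) => z.2.2 := by fun_prop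
  have h5 : Measurable fun z : (BanditHistory 𝒳 𝒜 t × 𝒳) × ((𝒪 × 𝒜) × ℝ) => z.2.1.2 := by
    fun_prop
  unfold tsScore roundScore score
  refine Measurable.ite (measurableSet_eq_fun h3 h5) ?_ measurable_const
  exact ((measurable_const.div h1).mul (h4.sub h2)).sub
    ((measurable_const.mul ((measurable_const.div h1).pow_const 2)).div_const 2)

variable {t v}
variable (hψ : Φ.IsAdmissibleRule ψ)
  (hS : ∀ᵐ h ∂(Φ.historyLaw ψ t), ∀ᵐ x ∂Φ.context, ∀ a : 𝒜,
    Φ.tsPosterior ψ t h {θ | ψ.1 (x, θ) = a} ≠ 0 → IsSubGaussianLaw v (Φ.tsPredictive ψ t h x a))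

include hS

omit [Fintype 𝒜] [MeasurableSingletonClass 𝒜] in
-- The assumption is an iterated almost-everywhere statement; measurability of `p` is what turns it
-- into one for the product law.
theorem ae_contextLaw_of_subGaussian {p : BanditHistory 𝒳 𝒜 t × 𝒳 → Prop}
    (hp : MeasurableSet {c | p c})
    (h : ∀ c, (∀ a, Φ.tsPosterior ψ t c.1 ((fun θ => ψ.1 (c.2, θ)) ⁻¹' {a}) ≠ 0 →
      IsSubGaussianLaw v (((Φ.rewardAt c.2).comap (fun θ => (θ, a)) (by fun_prop)) ∘ₘ
        Φ.tsPosterior ψ t c.1)) → p c) :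
    ∀ᵐ c ∂(Φ.contextLaw ψ t), p c := by
  rw [contextLaw, Measure.ae_prod_iff_ae_ae hp]
  filter_upwards [hS] with g hg
  filter_upwards [hg] with x hx
  exact h (g, x) hx

theorem integrable_tsScore : Integrable (tsScore Φ ψ t v lam) (Φ.roundLaw ψ t) := by
  have hm := measurable_tsScore Φ ψ t v lam
  rw [roundLaw, Measure.integrable_compProd_iff hm.aestronglyMeasurable]
  constructor
  · refine ae_contextLaw_of_subGaussian Φ ψ hS ?_ fun c hc => ?_
    · exact measurableSet_kernel_integrable (f := fun c z => tsScore Φ ψ t v lam (c, z))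
        (by exact hm.stronglyMeasurable)
    · rw [roundKernel_apply]
      exact integrable_roundScore (measurable_decision ψ c.2) hc lam
  · have hms : StronglyMeasurable fun c =>
        ∫ z, ‖tsScore Φ ψ t v lam (c, z)‖ ∂(Φ.roundKernel ψ t c) :=
      StronglyMeasurable.integral_kernel_prod_right'
        (f := fun q => ‖tsScore Φ ψ t v lam q‖) hm.norm.stronglyMeasurable
    refine Integrable.of_bound hms.aestronglyMeasurable
      (Fintype.card 𝒜 * (|lam| * (2 * Real.exp (v * 1 ^ 2 / 2) / 1) + v * lam ^ 2 / 2)) ?_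
    refine ae_contextLaw_of_subGaussian Φ ψ hS ?_ fun c hc => ?_
    · exact measurableSet_le hms.norm.measurable measurable_const
    · rw [Real.norm_of_nonneg (integral_nonneg fun _ => norm_nonneg _), roundKernel_apply]
      exact integral_abs_roundScore_le (measurable_decision ψ c.2) hc lam one_pos

theorem lintegral_exp_tsScore_le (θ : 𝒪) : ∀ᵐ c ∂(Φ.contextLaw ψ t),
    ∫⁻ z, ENNReal.ofReal (Real.exp (tsScore Φ ψ t v lam (c, ((θ, z.1.2), z.2))))
      ∂(Φ.roundKernel ψ t c) ≤ 1 := by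
  have hm := measurable_tsScore Φ ψ t v lam
  refine ae_contextLaw_of_subGaussian Φ ψ hS ?_ fun c hc => ?_
  · refine measurableSet_le (Measurable.lintegral_kernel_prod_right'
      (f := fun q : (BanditHistory 𝒳 𝒜 t × 𝒳) × ((𝒪 × 𝒜) × ℝ) => ENNReal.ofReal (Real.exp
        (tsScore Φ ψ t v lam (q.1, ((θ, q.2.1.2), q.2.2))))) (by fun_prop)) measurable_const
  · rw [roundKernel_apply]
    exact lintegral_exp_roundScore_le (measurable_decision ψ c.2) lam hc θ

include hψ

omit [Fintype 𝒜] [MeasurableSingletonClass 𝒜] hS in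
theorem integrable_informedKernel : Integrable (fun r : ℝ => r)
    (Φ.informedKernel ψ t ∘ₘ Φ.contextLaw ψ t) := by
  rw [informedKernel_comp]; exact hψ

/-- Integrability of the reward actually collected is derived, not assumed: it is dominated by that
of the admissible rule plus a constant. -/
theorem integrable_roundReward : Integrable (fun z => z.2.2) (Φ.roundLaw ψ t) := by
  have hm : Measurable fun z : (BanditHistory 𝒳 𝒜 t × 𝒳) × ((𝒪 × 𝒜) × ℝ) => z.2.2 := by
    fun_prop
  rw [roundLaw, Measure.integrable_compProd_iff hm.aestronglyMeasurable]
  constructor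
  · refine ae_contextLaw_of_subGaussian Φ ψ hS ?_ fun c hc => ?_
    · exact measurableSet_kernel_integrable (f := fun (_ : BanditHistory 𝒳 𝒜 t × 𝒳)
        (z : (𝒪 × 𝒜) × ℝ) => z.2) (by exact hm.stronglyMeasurable)
    · rw [roundKernel_apply]
      exact integrable_snd_sampledLaw (measurable_decision ψ c.2) hc
  · have hms : StronglyMeasurable fun c => ∫ z, ‖z.2‖ ∂(Φ.roundKernel ψ t c) :=
      StronglyMeasurable.integral_kernel (f := fun z : (𝒪 × 𝒜) × ℝ => ‖z.2‖)
        (Measurable.stronglyMeasurable (by fun_prop))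
    have hms' : StronglyMeasurable fun c => ∫ r, ‖r‖ ∂(Φ.informedKernel ψ t c) :=
      StronglyMeasurable.integral_kernel (f := fun r : ℝ => ‖r‖)
        (Measurable.stronglyMeasurable (by fun_prop))
    have hi := (integrable_informedKernel Φ ψ (t := t) hψ)
    have hi' : Integrable (fun c => ∫ r, ‖r‖ ∂(Φ.informedKernel ψ t c)) (Φ.contextLaw ψ t) :=
      ((Measure.integrable_comp_iff hi.1).1 hi).2
    refine (hi'.add (integrable_const
      (Fintype.card 𝒜 * (2 * (2 * Real.exp (v * 1 ^ 2 / 2) / 1))))).mono' hms.aestronglyMeasurable ?_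
    refine ae_contextLaw_of_subGaussian Φ ψ hS ?_ fun c hc => ?_
    · exact measurableSet_le hms.norm.measurable (hms'.measurable.add measurable_const)
    · rw [Real.norm_of_nonneg (integral_nonneg fun _ => norm_nonneg _), roundKernel_apply,
        Pi.add_apply, informedKernel_apply]
      exact integral_abs_sampledLaw_le (measurable_decision ψ c.2) hc one_pos

theorem regret_eq_integral : ∫ r, r ∂(Φ.ruleRewardLaw ψ) - ∫ z, z.2.2 ∂(Φ.roundLaw ψ t) =
    ∫ c, (∫ r, r ∂(Φ.informedKernel ψ t c) - ∫ z, z.2 ∂(Φ.roundKernel ψ t c))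
      ∂(Φ.contextLaw ψ t) ∧ Integrable (fun c => ∫ r, r ∂(Φ.informedKernel ψ t c) -
        ∫ z, z.2 ∂(Φ.roundKernel ψ t c)) (Φ.contextLaw ψ t) := by
  have hi := integrable_informedKernel Φ ψ (t := t) hψ
  have hr := integrable_roundReward Φ ψ hψ hS
  have e1 : ∫ r, r ∂(Φ.ruleRewardLaw ψ) =
      ∫ c, ∫ r, r ∂(Φ.informedKernel ψ t c) ∂(Φ.contextLaw ψ t) := by
    rw [← informedKernel_comp Φ ψ t, Measure.integral_comp_eq hi]
  have e2 : ∫ z, z.2.2 ∂(Φ.roundLaw ψ t) =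
      ∫ c, ∫ z, z.2 ∂(Φ.roundKernel ψ t c) ∂(Φ.contextLaw ψ t) :=
    Measure.integral_compProd hr
  have i1 : Integrable (fun c => ∫ r, r ∂(Φ.informedKernel ψ t c)) (Φ.contextLaw ψ t) :=
    hi.integral_measure_comp
  have i2 : Integrable (fun c => ∫ z, z.2 ∂(Φ.roundKernel ψ t c)) (Φ.contextLaw ψ t) :=
    hr.integral_measure_compProd
  exact ⟨by rw [e1, e2, integral_sub i1 i2], i1.sub i2⟩

omit [Fintype 𝒜] [MeasurableSingletonClass 𝒜] hψ hS in
theorem measurable_conditionalRegret : Measurable fun c => ∫ r, r ∂(Φ.informedKernel ψ t c) -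
    ∫ z, z.2 ∂(Φ.roundKernel ψ t c) :=
  (StronglyMeasurable.integral_kernel (f := fun r : ℝ => r)
    measurable_id.stronglyMeasurable).measurable.sub
  (StronglyMeasurable.integral_kernel (f := fun z : (𝒪 × 𝒜) × ℝ => z.2)
    measurable_snd.stronglyMeasurable).measurable

theorem roundRegret_le {s : ℝ} (hs : 0 < s) :
    ∫ r, r ∂(Φ.ruleRewardLaw ψ) - ∫ z, z.2.2 ∂(Φ.roundLaw ψ t) ≤
      Fintype.card 𝒜 * (2 * Real.exp (v * s ^ 2 / 2) / s) := by
  obtain ⟨h1, h2⟩ := regret_eq_integral Φ ψ hψ hS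
  rw [h1]
  refine (integral_mono_ae h2 (integrable_const
    (Fintype.card 𝒜 * (2 * Real.exp (v * s ^ 2 / 2) / s))) ?_).trans (by simp)
  refine ae_contextLaw_of_subGaussian Φ ψ hS ?_ fun c hc => ?_
  · exact measurableSet_le (measurable_conditionalRegret Φ ψ) measurable_const
  · beta_reduce
    rw [roundKernel_apply, informedKernel_apply]
    exact informed_sub_sampled_le (measurable_decision ψ c.2) hc hs

theorem le_integral_tsScore :
    lam * (∫ r, r ∂(Φ.ruleRewardLaw ψ) - ∫ z, z.2.2 ∂(Φ.roundLaw ψ t)) -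
      Fintype.card 𝒜 * (v * lam ^ 2 / 2) ≤ ∫ z, tsScore Φ ψ t v lam z ∂(Φ.roundLaw ψ t) := by
  obtain ⟨h1, h2⟩ := regret_eq_integral Φ ψ hψ hS
  have hw := integrable_tsScore Φ ψ lam hS
  have hm := measurable_tsScore Φ ψ t v lam
  have e1 : ∫ z, tsScore Φ ψ t v lam z ∂(Φ.roundLaw ψ t) =
      ∫ c, ∫ z, tsScore Φ ψ t v lam (c, z) ∂(Φ.roundKernel ψ t c) ∂(Φ.contextLaw ψ t) :=
    Measure.integral_compProd hw
  have i1 : Integrable (fun c => ∫ z, tsScore Φ ψ t v lam (c, z) ∂(Φ.roundKernel ψ t c))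
      (Φ.contextLaw ψ t) := hw.integral_measure_compProd
  have hms : StronglyMeasurable fun c =>
      ∫ z, tsScore Φ ψ t v lam (c, z) ∂(Φ.roundKernel ψ t c) :=
    StronglyMeasurable.integral_kernel_prod_right' hm.stronglyMeasurable
  have e2 : ∫ c, (lam * (∫ r, r ∂(Φ.informedKernel ψ t c) - ∫ z, z.2 ∂(Φ.roundKernel ψ t c)) -
      Fintype.card 𝒜 * (v * lam ^ 2 / 2)) ∂(Φ.contextLaw ψ t) =
      lam * (∫ r, r ∂(Φ.ruleRewardLaw ψ) - ∫ z, z.2.2 ∂(Φ.roundLaw ψ t)) -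
      Fintype.card 𝒜 * (v * lam ^ 2 / 2) := by
    rw [integral_sub (h2.const_mul _) (integrable_const _), integral_const_mul, h1]
    simp
  rw [e1, ← e2]
  refine integral_mono_ae ((h2.const_mul _).sub (integrable_const _)) i1 ?_
  refine ae_contextLaw_of_subGaussian Φ ψ hS ?_ fun c hc => ?_
  · exact measurableSet_le (((measurable_conditionalRegret Φ ψ).const_mul _).sub measurable_const)
      hms.measurable
  · beta_reduce
    rw [roundKernel_apply, informedKernel_apply]
    exact le_integral_roundScore (measurable_decision ψ c.2) hc lam

end Round

end ContextualBandit

/-! ### The entropy bound and the choice of the free parameter. -/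

theorem ae_measureReal_singleton_pos {S : Type*} [MeasurableSpace S]
    {μ : Measure S} [IsFiniteMeasure μ] {C : Set S} (hC : C.Countable) (hμ : μ Cᶜ = 0) :
    ∀ᵐ s ∂μ, 0 < μ.real {s} := by
  have h1 : ∀ᵐ s ∂μ, s ∈ C := mem_ae_iff.2 hμ
  have h2 : ∀ᵐ s ∂μ, ∀ c ∈ C, μ {c} = 0 → s ≠ c := by
    refine (ae_ball_iff hC).2 fun c _ => ?_
    by_cases hc : μ {c} = 0
    · filter_upwards [compl_mem_ae_iff.2 hc] with s hs _ using hs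
    · exact ae_of_all _ fun s h => absurd h hc
  filter_upwards [h1, h2] with s hs hs'
  exact ENNReal.toReal_pos (fun h => hs' s hs h rfl) (measure_ne_top _ _)

theorem lintegral_neg_log_le_shannonEntropy {S : Type*} [MeasurableSpace S]
    [MeasurableSingletonClass S] (μ : Measure S) [IsProbabilityMeasure μ]
    {C : Set S} (hC : C.Countable) (hμ : μ Cᶜ = 0) :
    ∫⁻ s, ENNReal.ofReal (-Real.log (μ.real {s})) ∂μ ≤ shannonEntropy μ := by
  have hr : μ.restrict C = μ := Measure.restrict_eq_self_of_ae_mem (mem_ae_iff.2 hμ)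
  rw [shannonEntropy, if_pos ⟨C, hC, hμ⟩]
  calc ∫⁻ s, ENNReal.ofReal (-Real.log (μ.real {s})) ∂μ
      = ∫⁻ s in C, ENNReal.ofReal (-Real.log (μ.real {s})) ∂μ := by rw [hr]
    _ = ∑' s : C, ENNReal.ofReal (-Real.log (μ.real {(s : S)})) * μ {(s : S)} :=
        lintegral_countable _ hC
    _ = ∑' s : C, ENNReal.ofReal (Real.negMulLog (μ.real {(s : S)})) := by
        refine tsum_congr fun s => ?_
        rw [Real.negMulLog, neg_mul, ← mul_neg, ENNReal.ofReal_mul measureReal_nonneg,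
          ofReal_measureReal (measure_ne_top _ _), mul_comm]
    _ ≤ _ := ENNReal.tsum_comp_le_tsum_of_injective Subtype.val_injective _

/-- The singletons are the sections of the diagonal, which is measurable in a standard Borel space.
-/
theorem measurable_measure_singleton {S : Type*} [MeasurableSpace S] [StandardBorelSpace S]
    (μ : Measure S) [SFinite μ] : Measurable fun s => μ {s} := by
  have h := measurable_measure_prodMk_left (ν := μ) (measurableSet_diagonal (α := S))
  convert h using 3 with s
  ext u
  simp [eq_comm]

theorem measure_singleton_smul_le_comp {S Y : Type*} [MeasurableSpace S]
    [MeasurableSingletonClass S] [MeasurableSpace Y] (μ : Measure S) (κ : Kernel S Y) (s : S) :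
    μ {s} • κ s ≤ κ ∘ₘ μ := by
  refine Measure.le_iff.2 fun E hE => ?_
  rw [Measure.bind_apply hE (Kernel.aemeasurable _), Measure.smul_apply, smul_eq_mul, mul_comm,
    ← lintegral_singleton (fun u => κ u E)]
  exact setLIntegral_le_lintegral _ _

/-- A Donsker-Varadhan bound: a test function whose exponential integrates to at most one against
the marginal law, for each value of the parameter, has an expectation of at most the entropy of the
parameter. -/
theorem integral_compProd_le_shannonEntropy {S Y : Type*} [MeasurableSpace S] [StandardBorelSpace S]
    [MeasurableSpace Y] (μ : Measure S) [IsProbabilityMeasure μ] (κ : Kernel S Y) [IsMarkovKernel κ]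
    {W : S × Y → ℝ} (hm : Measurable W) (hi : Integrable W (μ ⊗ₘ κ))
    (hW : ∀ s, ∫⁻ y, ENNReal.ofReal (Real.exp (W (s, y))) ∂(κ ∘ₘ μ) ≤ 1)
    (hH : shannonEntropy μ ≠ ∞) : ∫ q, W q ∂(μ ⊗ₘ κ) ≤ (shannonEntropy μ).toReal := by
  obtain ⟨C, hC, hμ⟩ : ∃ C : Set S, C.Countable ∧ μ Cᶜ = 0 := by
    by_contra h
    exact hH (by rw [shannonEntropy, if_neg h])
  have hpm' := measurable_measure_singleton μ
  have hpm : Measurable fun s => μ.real {s} := hpm'.ennreal_toReal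
  have hpos := ae_measureReal_singleton_pos hC hμ
  have hle := lintegral_neg_log_le_shannonEntropy μ hC hμ
  have hnn : 0 ≤ᵐ[μ] fun s => -Real.log (μ.real {s}) := ae_of_all _ fun s =>
    neg_nonneg.2 (Real.log_nonpos measureReal_nonneg measureReal_le_one)
  have hlm : AEStronglyMeasurable (fun s => -Real.log (μ.real {s})) μ :=
    (hpm.log.neg).aestronglyMeasurable
  have hli : Integrable (fun s => -Real.log (μ.real {s})) μ :=
    (lintegral_ofReal_ne_top_iff_integrable hlm hnn).1 (ne_top_of_le_ne_top hH hle)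
  have hlH : ∫ s, -Real.log (μ.real {s}) ∂μ ≤ (shannonEntropy μ).toReal := by
    rw [integral_eq_lintegral_of_nonneg_ae hnn hlm]
    exact ENNReal.toReal_mono hH hle
  have hfst : (μ ⊗ₘ κ).map Prod.fst = μ := Measure.fst_compProd _ _
  have hli' : Integrable (fun q : S × Y => -Real.log (μ.real {q.1})) (μ ⊗ₘ κ) := by
    exact (integrable_map_measure (f := Prod.fst) (g := fun s => -Real.log (μ.real {s}))
      (by rw [hfst]; exact hlm) (by fun_prop)).1 (by rw [hfst]; exact hli)
  have hlI : ∫ q : S × Y, -Real.log (μ.real {q.1}) ∂(μ ⊗ₘ κ) = ∫ s, -Real.log (μ.real {s}) ∂μ := by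
    conv_rhs => rw [← hfst]
    rw [integral_map (by fun_prop) (by rw [hfst]; exact hlm), hfst]
  -- The mass `μ {s}` times the conditional law is at most the marginal law, so the factor `μ.real
  -- {s}` trades the conditional law for the marginal, where `hW` applies.
  have hbound : ∫⁻ q, ENNReal.ofReal (Real.exp (W q) * μ.real {q.1}) ∂(μ ⊗ₘ κ) ≤ 1 := by
    have hmm : Measurable fun q : S × Y => ENNReal.ofReal (Real.exp (W q) * μ.real {q.1}) :=
      ((hm.exp).mul (hpm.comp measurable_fst)).ennreal_ofReal
    rw [Measure.lintegral_compProd hmm]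
    calc ∫⁻ s, ∫⁻ y, ENNReal.ofReal (Real.exp (W (s, y)) * μ.real {s}) ∂(κ s) ∂μ
        ≤ ∫⁻ s, 1 ∂μ := by
          refine lintegral_mono fun s => ?_
          calc ∫⁻ y, ENNReal.ofReal (Real.exp (W (s, y)) * μ.real {s}) ∂(κ s)
              = ∫⁻ y, ENNReal.ofReal (Real.exp (W (s, y))) ∂(μ {s} • κ s) := by
                rw [lintegral_smul_measure, smul_eq_mul, mul_comm, ← lintegral_mul_const _ (by fun_prop)]
                refine lintegral_congr fun y => ?_
                rw [ENNReal.ofReal_mul (Real.exp_pos _).le, ofReal_measureReal (measure_ne_top _ _)]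
            _ ≤ ∫⁻ y, ENNReal.ofReal (Real.exp (W (s, y))) ∂(κ ∘ₘ μ) :=
                lintegral_mono' (measure_singleton_smul_le_comp μ κ s) le_rfl
            _ ≤ 1 := hW s
      _ = 1 := by simp
  have hgm : AEStronglyMeasurable (fun q : S × Y => Real.exp (W q) * μ.real {q.1}) (μ ⊗ₘ κ) :=
    ((hm.exp).mul (hpm.comp measurable_fst)).aestronglyMeasurable
  have hgn : 0 ≤ᵐ[μ ⊗ₘ κ] fun q : S × Y => Real.exp (W q) * μ.real {q.1} :=
    ae_of_all _ fun q => mul_nonneg (Real.exp_pos _).le measureReal_nonneg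
  have hgi : Integrable (fun q : S × Y => Real.exp (W q) * μ.real {q.1}) (μ ⊗ₘ κ) :=
    (lintegral_ofReal_ne_top_iff_integrable hgm hgn).1 (ne_top_of_le_ne_top ENNReal.one_ne_top hbound)
  have hgI : ∫ q : S × Y, Real.exp (W q) * μ.real {q.1} ∂(μ ⊗ₘ κ) ≤ 1 := by
    rw [integral_eq_lintegral_of_nonneg_ae hgn hgm]
    exact ENNReal.toReal_mono ENNReal.one_ne_top hbound
  have hpos' : ∀ᵐ q : S × Y ∂(μ ⊗ₘ κ), 0 < μ.real {q.1} := by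
    exact ae_of_ae_map (f := Prod.fst) (p := fun s => 0 < μ.real {s}) (by fun_prop)
      (by rwa [hfst])
  have hkey : ∫ q, W q ∂(μ ⊗ₘ κ) ≤
      ∫ q : S × Y, (-Real.log (μ.real {q.1}) + (Real.exp (W q) * μ.real {q.1} - 1)) ∂(μ ⊗ₘ κ) := by
    refine integral_mono_ae hi (hli'.add (hgi.sub (integrable_const 1))) ?_
    filter_upwards [hpos'] with q hq
    -- `log x ≤ x - 1` at `x = exp (W q) * μ.real {q.1}` gives `W ≤ -log μ{s} + (x - 1)`; the last
    -- term has mean at most zero. Positivity of the atom matters since `Real.log 0 = 0`.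
    have := Real.log_le_sub_one_of_pos (mul_pos (Real.exp_pos (W q)) hq)
    rw [Real.log_mul (Real.exp_pos _).ne' hq.ne', Real.log_exp] at this
    linarith
  rw [integral_add hli' (by exact hgi.sub (integrable_const 1)), integral_sub hgi (integrable_const 1),
    hlI] at hkey
  simp only [integral_const, probReal_univ, smul_eq_mul, mul_one] at hkey
  linarith

theorem le_sqrt_of_forall_mul_le {R b h : ℝ} (hb : 0 ≤ b) (hh : 0 ≤ h)
    (H : ∀ lam : ℝ, 0 < lam → lam * R ≤ h + b * lam ^ 2) : R ≤ √(4 * b * h) := by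
  rcases le_or_gt R 0 with hR | hR
  · exact hR.trans (Real.sqrt_nonneg _)
  refine Real.le_sqrt_of_sq_le ?_
  -- The quadratic `b * x ^ 2 - R * x + h` is nonnegative for `x > 0` by `H`, and for `x ≤ 0`
  -- because every term is nonnegative when `R > 0`.
  have := discrim_le_zero (a := b) (b := -R) (c := h) fun x => by
    rcases le_or_gt x 0 with hx | hx
    · nlinarith [mul_nonneg hb (mul_self_nonneg x), mul_nonneg hR.le (neg_nonneg.2 hx)]
    · nlinarith [H x hx]
  rw [discrim] at this
  linarith

/-! ### Summation over the rounds and the regret bound. -/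

namespace ContextualBandit

variable {𝒳 𝒜 𝒪 : Type*} [MeasurableSpace 𝒳] [MeasurableSpace 𝒜] [MeasurableSpace 𝒪]

/-- The supremum is attained, so the real `sSup` is a true maximum and not its default value. -/
theorem optimalReward_eq (Φ : ContextualBandit 𝒳 𝒜 𝒪) {T : ℕ} {ψ : DecisionRule 𝒳 𝒜 𝒪}
    (hψ : Φ.IsOptimalRule T ψ) : Φ.optimalReward T = T * ∫ r, r ∂(Φ.ruleRewardLaw ψ) := by
  have h : IsGreatest (Φ.ruleReward T '' {ψ | Φ.IsAdmissibleRule ψ}) (Φ.ruleReward T ψ) :=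
    ⟨⟨ψ, hψ.1, rfl⟩, by rintro _ ⟨ψ', h', rfl⟩; exact hψ.2 ψ' h'⟩
  rw [optimalReward, h.csSup_eq, ruleReward]
  simp

variable [StandardBorelSpace 𝒪] [Nonempty 𝒪] [Fintype 𝒜] [MeasurableSingletonClass 𝒜]
  (Φ : ContextualBandit 𝒳 𝒜 𝒪) (ψ : DecisionRule 𝒳 𝒜 𝒪) {v : ℝ≥0} {T : ℕ}

omit [MeasurableSpace 𝒳] [MeasurableSpace 𝒜] [MeasurableSpace 𝒪] [StandardBorelSpace 𝒪]
  [Nonempty 𝒪] [Fintype 𝒜] [MeasurableSingletonClass 𝒜] in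
theorem sum_nextHistory {t : ℕ} (z : (BanditHistory 𝒳 𝒜 t × 𝒳) × ((𝒪 × 𝒜) × ℝ)) :
    ∑ i, (nextHistory z i).2.2 = ∑ i, (z.1.1 i).2.2 + z.2.2 := by
  simp [nextHistory, Fin.sum_univ_castSucc]

omit [Fintype 𝒜] [MeasurableSingletonClass 𝒜] in
theorem tsReward_eq (t : ℕ) :
    Φ.tsReward t ψ = ∫ h, ∑ i : Fin t, (h i).2.2 ∂(Φ.historyLaw ψ t) := rfl

omit [Fintype 𝒜] [MeasurableSingletonClass 𝒜] in
theorem integrable_sum_succ {t : ℕ}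
    (hi : Integrable (fun h => ∑ i : Fin t, (h i).2.2) (Φ.historyLaw ψ t))
    (hr : Integrable (fun z => z.2.2) (Φ.roundLaw ψ t)) :
    Integrable (fun h => ∑ i : Fin (t + 1), (h i).2.2) (Φ.historyLaw ψ (t + 1)) ∧
      Φ.tsReward (t + 1) ψ = Φ.tsReward t ψ + ∫ z, z.2.2 ∂(Φ.roundLaw ψ t) := by
  have hm : ∀ n, Measurable fun h : BanditHistory 𝒳 𝒜 n => ∑ i, (h i).2.2 := fun n => by fun_prop
  have hn := measurable_nextHistory (𝒳 := 𝒳) (𝒜 := 𝒜) (𝒪 := 𝒪) t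
  rw [historyLaw_eq_map, integrable_map_measure (hm t).aestronglyMeasurable (by fun_prop)] at hi
  replace hi : Integrable (fun z => ∑ i, (z.1.1 i).2.2) (Φ.roundLaw ψ t) := hi
  constructor
  · rw [historyLaw_succ_eq_map, integrable_map_measure (hm _).aestronglyMeasurable hn.aemeasurable]
    exact (hi.add hr).congr (ae_of_all _ fun z => (sum_nextHistory z).symm)
  · rw [tsReward_eq, tsReward_eq, historyLaw_succ_eq_map,
      integral_map hn.aemeasurable (hm _).aestronglyMeasurable, historyLaw_eq_map,
      integral_map (by fun_prop) (hm _).aestronglyMeasurable, ← integral_add hi hr]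
    exact integral_congr_ae (ae_of_all _ sum_nextHistory)

variable (hψ : Φ.IsAdmissibleRule ψ) (hS : Φ.SubGaussianRewards T ψ v)
include hψ hS

/-- Provides integrability of the cumulative reward, and the entropy-free bound that settles the
degenerate case of infinite entropy. -/
theorem regret_le_of_le {t : ℕ} (ht : t ≤ T) {s : ℝ} (hs : 0 < s) :
    Integrable (fun h => ∑ i : Fin t, (h i).2.2) (Φ.historyLaw ψ t) ∧
      t * ∫ r, r ∂(Φ.ruleRewardLaw ψ) - Φ.tsReward t ψ ≤
        t * (Fintype.card 𝒜 * (2 * Real.exp (v * s ^ 2 / 2) / s)) := by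
  induction t with
  | zero => simp [tsReward]
  | succ t ih =>
    obtain ⟨h1, h2⟩ := ih (by omega)
    have hr := integrable_roundReward Φ ψ hψ (hS t ht)
    obtain ⟨h3, h4⟩ := integrable_sum_succ Φ ψ h1 hr
    refine ⟨h3, ?_⟩
    have h5 := roundRegret_le Φ ψ hψ (hS t ht) hs
    rw [h4]
    push_cast
    linarith

/-- For each fixed `θ`, the exponential of the accumulated score is a supermartingale under the
marginal law of the history, while under the joint law the score gains at least `lam` times the
regret of each round, less a fixed cost. -/
theorem exists_potential (lam : ℝ) {t : ℕ} (ht : t ≤ T) : ∃ W : 𝒪 × BanditHistory 𝒳 𝒜 t → ℝ,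
    Measurable W ∧ Integrable W (Φ.jointLaw ψ t) ∧
    (∀ θ, ∫⁻ h, ENNReal.ofReal (Real.exp (W (θ, h))) ∂(Φ.historyLaw ψ t) ≤ 1) ∧
    lam * (t * ∫ r, r ∂(Φ.ruleRewardLaw ψ) - Φ.tsReward t ψ) -
      t * (Fintype.card 𝒜 * (v * lam ^ 2 / 2)) ≤ ∫ q, W q ∂(Φ.jointLaw ψ t) := by
  induction t with
  | zero => exact ⟨fun _ => 0, measurable_const, integrable_const _, by simp, by simp [tsReward]⟩
  | succ t ih =>
    obtain ⟨W, hWm, hWi, hW1, hW2⟩ := ih (by omega)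
    have hSt := hS t ht
    have hsm := measurable_tsScore Φ ψ t v lam
    have hsi := integrable_tsScore Φ ψ lam hSt
    have hn := measurable_nextHistory (𝒳 := 𝒳) (𝒜 := 𝒜) (𝒪 := 𝒪) t
    have hn' : Measurable fun z : (BanditHistory 𝒳 𝒜 t × 𝒳) × ((𝒪 × 𝒜) × ℝ) =>
        (z.2.1.1, nextHistory z) := by fun_prop
    -- The old potential on the first `t` rounds plus the score of the new round, read off the last
    -- entry of the history.
    let W' : 𝒪 × BanditHistory 𝒳 𝒜 (t + 1) → ℝ := fun q => W (q.1, Fin.init q.2) +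
      tsScore Φ ψ t v lam ((Fin.init q.2, (q.2 (Fin.last t)).2.1),
        ((q.1, (q.2 (Fin.last t)).1), (q.2 (Fin.last t)).2.2))
    have hinit : Measurable fun h : BanditHistory 𝒳 𝒜 (t + 1) =>
        (Fin.init h : BanditHistory 𝒳 𝒜 t) :=
      measurable_pi_lambda _ fun i => measurable_pi_apply i.castSucc
    have hW'm : Measurable W' := by fun_prop
    have hW'n : ∀ θ (z : (BanditHistory 𝒳 𝒜 t × 𝒳) × ((𝒪 × 𝒜) × ℝ)), W' (θ, nextHistory z) =
        W (θ, z.1.1) + tsScore Φ ψ t v lam (z.1, ((θ, z.2.1.2), z.2.2)) := by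
      intro θ z
      simp [W', nextHistory]
    rw [jointLaw_eq_map] at hWi hW2
    rw [integrable_map_measure hWm.aestronglyMeasurable (by fun_prop)] at hWi
    replace hWi : Integrable (fun z => W (z.2.1.1, z.1.1)) (Φ.roundLaw ψ t) := hWi
    rw [integral_map (by fun_prop) hWm.aestronglyMeasurable] at hW2
    refine ⟨W', hW'm, ?_, fun θ => ?_, ?_⟩
    · rw [jointLaw_succ_eq_map, integrable_map_measure hW'm.aestronglyMeasurable hn'.aemeasurable]
      exact (hWi.add hsi).congr (ae_of_all _ fun z => (hW'n z.2.1.1 z).symm)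
    · rw [historyLaw_succ_eq_map, lintegral_map (by fun_prop) hn, roundLaw,
        Measure.lintegral_compProd (by fun_prop)]
      simp_rw [hW'n, Real.exp_add, ENNReal.ofReal_mul (Real.exp_pos _).le]
      calc _ ≤ ∫⁻ c, ENNReal.ofReal (Real.exp (W (θ, c.1))) ∂(Φ.contextLaw ψ t) := by
            refine lintegral_mono_ae ?_
            -- Supermartingale step: the old factor depends only on the history, and the new one has
            -- conditional mean at most one.
            filter_upwards [lintegral_exp_tsScore_le Φ ψ lam hSt θ] with c hc
            rw [lintegral_const_mul _ (by fun_prop)]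
            exact mul_le_of_le_one_right' hc
        _ = ∫⁻ h, ENNReal.ofReal (Real.exp (W (θ, h))) ∂(Φ.historyLaw ψ t) := by
            rw [contextLaw, lintegral_prod _ (by fun_prop)]
            simp
        _ ≤ 1 := hW1 θ
    · have h1 := (regret_le_of_le Φ ψ hψ hS (t := t) (by omega) one_pos).1
      have h4 := (integrable_sum_succ Φ ψ h1 (integrable_roundReward Φ ψ hψ hSt)).2
      have h5 := le_integral_tsScore Φ ψ lam hψ hSt
      have h6 : ∫ q, W' q ∂(Φ.jointLaw ψ (t + 1)) =
          ∫ z, W (z.2.1.1, z.1.1) ∂(Φ.roundLaw ψ t) + ∫ z, tsScore Φ ψ t v lam z ∂(Φ.roundLaw ψ t) := by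
        rw [jointLaw_succ_eq_map, integral_map hn'.aemeasurable hW'm.aestronglyMeasurable,
          ← integral_add hWi hsi]
        exact integral_congr_ae (ae_of_all _ fun z => hW'n z.2.1.1 z)
      rw [h6, h4]
      push_cast
      linarith

theorem mul_regret_le (hH : shannonEntropy Φ.prior ≠ ∞) (lam : ℝ) :
    lam * (T * ∫ r, r ∂(Φ.ruleRewardLaw ψ) - Φ.tsReward T ψ) ≤
      (shannonEntropy Φ.prior).toReal + T * (Fintype.card 𝒜 * (v * lam ^ 2 / 2)) := by
  obtain ⟨W, hWm, hWi, hW1, hW2⟩ := exists_potential Φ ψ hψ hS lam le_rfl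
  have := integral_compProd_le_shannonEntropy Φ.prior (Φ.tsHistory ψ T) hWm hWi hW1 hH
  rw [jointLaw] at hW2
  linarith

omit hψ in
theorem tsRegret_le (hopt : Φ.IsOptimalRule T ψ) : ((Φ.tsRegret T ψ : ℝ) : EReal) ≤
    (((2 * (v : ℝ≥0∞) * (Fintype.card 𝒜 : ℝ≥0∞) * (T : ℝ≥0∞) *
      shannonEntropy Φ.prior) ^ (1 / 2 : ℝ) : ℝ≥0∞) : EReal) := by
  have hψ := hopt.1
  rw [tsRegret, optimalReward_eq Φ hopt]
  set R := T * ∫ r, r ∂(Φ.ruleRewardLaw ψ) - Φ.tsReward T ψ with hR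
  by_cases hH : shannonEntropy Φ.prior = ∞
  · rw [hH]
    -- With infinite entropy the bound is trivial unless another factor vanishes; then `0 * ∞ = 0`
    -- and the regret must be shown to be nonpositive.
    by_cases h0 : 2 * (v : ℝ≥0∞) * (Fintype.card 𝒜 : ℝ≥0∞) * (T : ℝ≥0∞) = 0
    · have hb : ∀ s : ℝ, 0 < s → R * s ≤ 2 * (T * Fintype.card 𝒜) := by
        intro s hs
        have h1 := (regret_le_of_le Φ ψ hψ hS le_rfl hs).2
        rw [← hR] at h1
        simp only [mul_eq_zero, OfNat.ofNat_ne_zero, false_or, ENNReal.coe_eq_zero,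
          Nat.cast_eq_zero] at h0
        rcases h0 with (h0 | h0) | h0
        · simp only [h0, NNReal.coe_zero, zero_mul, zero_div, Real.exp_zero, mul_one] at h1
          have h2 := mul_le_mul_of_nonneg_right h1 hs.le
          refine h2.trans (le_of_eq ?_)
          field_simp
        · simp only [h0, Nat.cast_zero, zero_mul, mul_zero] at h1 ⊢
          exact mul_nonpos_of_nonpos_of_nonneg h1 hs.le
        · simp only [h0, Nat.cast_zero, zero_mul, mul_zero] at h1 ⊢
          exact mul_nonpos_of_nonpos_of_nonneg h1 hs.le
      have hR0 : R ≤ 0 := by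
        by_contra! hpos
        have hc : (0 : ℝ) ≤ 2 * (T * Fintype.card 𝒜) := by positivity
        -- If `R` were positive, this `s` would make `R * s` exceed its bound by one.
        have := hb ((2 * (T * Fintype.card 𝒜) + 1) / R) (by positivity)
        rw [mul_div_cancel₀ _ hpos.ne'] at this
        linarith
      exact (EReal.coe_le_coe_iff.2 hR0).trans (EReal.coe_ennreal_nonneg _)
    · rw [ENNReal.mul_top h0, ENNReal.top_rpow_of_pos (by norm_num)]
      exact le_top
  · have h1 : R ≤ √(4 * (T * (Fintype.card 𝒜 * (v / 2))) * (shannonEntropy Φ.prior).toReal) :=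
      le_sqrt_of_forall_mul_le (by positivity) ENNReal.toReal_nonneg fun lam _ => by
        have := mul_regret_le Φ ψ hψ hS hH lam
        rw [← hR] at this
        linarith
    have h2 : (2 * (v : ℝ≥0∞) * (Fintype.card 𝒜 : ℝ≥0∞) * (T : ℝ≥0∞) * shannonEntropy Φ.prior) =
        ENNReal.ofReal (4 * (T * (Fintype.card 𝒜 * (v / 2))) *
          (shannonEntropy Φ.prior).toReal) := by
      rw [ENNReal.ofReal_mul (by positivity), ENNReal.ofReal_toReal hH]
      congr 1
      rw [show (4 * (T * (Fintype.card 𝒜 * (v / 2))) : ℝ) =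
        ((2 * v * Fintype.card 𝒜 * T : ℝ≥0) : ℝ) by push_cast; ring, ENNReal.ofReal_coe_nnreal]
      push_cast
      rfl
    rw [h2, ENNReal.ofReal_rpow_of_nonneg (by positivity) (by norm_num), ← Real.sqrt_eq_rpow,
      EReal.coe_ennreal_ofReal, max_eq_left (Real.sqrt_nonneg _)]
    exact EReal.coe_le_coe_iff.2 h1

omit [Fintype 𝒜] [MeasurableSingletonClass 𝒜] hψ hS in
theorem subGaussianRewards_of_rewardsIn {L : ℝ≥0} (h : Φ.RewardsIn L) :
    Φ.SubGaussianRewards T ψ ((L / 2) ^ 2) := by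
  intro t _
  refine ae_of_all _ fun g => ae_of_all _ fun x a _ => ?_
  have : IsProbabilityMeasure (Φ.tsPredictive ψ t g x a) := by unfold tsPredictive; infer_instance
  refine isSubGaussianLaw_of_mem_Icc ?_
  exact Measure.ae_comp_of_ae_ae measurableSet_Icc (ae_of_all _ fun θ => h x a θ)

omit [StandardBorelSpace 𝒪] [Fintype 𝒜] [MeasurableSingletonClass 𝒜] hψ hS in
theorem nonneg_of_rewardsIn (ψ : DecisionRule 𝒳 𝒜 𝒪) {L : ℝ} (h : Φ.RewardsIn L) : 0 ≤ L := by
  obtain ⟨x⟩ := nonempty_of_isProbabilityMeasure Φ.context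
  obtain ⟨θ⟩ := ‹Nonempty 𝒪›
  obtain ⟨r, hr⟩ := (h x (ψ.1 (x, θ)) θ).exists
  exact hr.1.trans hr.2

end ContextualBandit

theorem corollary1 {𝒳 𝒜 𝒪 : Type*} [MeasurableSpace 𝒳]
    [Fintype 𝒜] [MeasurableSpace 𝒜] [MeasurableSingletonClass 𝒜]
    [MeasurableSpace 𝒪] [StandardBorelSpace 𝒪] [Nonempty 𝒪]
    (Φ : ContextualBandit 𝒳 𝒜 𝒪) (T : ℕ) (ψ : DecisionRule 𝒳 𝒜 𝒪)
    (hψ : Φ.IsOptimalRule T ψ) :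
    (∀ L : ℝ, Φ.RewardsIn L →
      ((Φ.tsRegret T ψ : ℝ) : EReal) ≤
        (((ENNReal.ofReal (L ^ 2 / 2) * (Fintype.card 𝒜 : ℝ≥0∞) * (T : ℝ≥0∞) *
          shannonEntropy Φ.prior) ^ (1 / 2 : ℝ) : ℝ≥0∞) : EReal)) ∧
    (∀ σ : ℝ≥0, Φ.SubGaussianRewards T ψ (σ ^ 2) →
      ((Φ.tsRegret T ψ : ℝ) : EReal) ≤
        (((2 * (σ : ℝ≥0∞) ^ 2 * (Fintype.card 𝒜 : ℝ≥0∞) * (T : ℝ≥0∞) *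
          shannonEntropy Φ.prior) ^ (1 / 2 : ℝ) : ℝ≥0∞) : EReal)) := by
  refine ⟨fun L hL => ?_, fun σ hσ => ?_⟩
  · lift L to ℝ≥0 using Φ.nonneg_of_rewardsIn ψ hL
    have h := Φ.tsRegret_le ψ (Φ.subGaussianRewards_of_rewardsIn ψ hL) hψ
    -- Twice the Hoeffding proxy `(L / 2) ^ 2` is `L ^ 2 / 2`.
    have e : ENNReal.ofReal ((L : ℝ) ^ 2 / 2) = 2 * (((L / 2) ^ 2 : ℝ≥0) : ℝ≥0∞) := by
      rw [show ((L : ℝ) ^ 2 / 2) = ((2 * (L / 2) ^ 2 : ℝ≥0) : ℝ) by push_cast; ring,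
        ENNReal.ofReal_coe_nnreal]
      push_cast
      rfl
    rwa [e]
  · have h := Φ.tsRegret_le ψ hσ hψ
    rwa [ENNReal.coe_pow] at h
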